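/- **Theorem (ergodic coverage probability).** *Model.* A base station with $N_{BS}\ge 1$ antennas is at the centre $0$ of a cell, the disk of radius $R>0$ in the plane. Users, with $N_u\ge1$ antennas each, form a Poisson point process in the cell with density $\lambda_u(\|x\|)\ge 0$ at $x$, where $0<\int_0^R\lambda_u(\xi)2\pi\xi\,d\xi<\infty$. Reflecting surfaces (RISs), with $N_R\ge1$ elements each, form a Poisson point process in the cell with constant density $\lambda_R>0$. A link of length $d$ is line-of-sight (LoS) with probability $P_{LoS}(d)=\exp(-\tfrac{2\lambda_bE[L]d}{\pi})$, where $\lambda_b\ge0$ is the blockage density and $E[L]$ is the mean of a blockage length uniform on $[L_{\min},L_{\max}]$, $0\le L_{\min}\le L_{\max}$; BS–RIS links are always LoS. Small-scale fading gains are exponential: $h_d$ (BS–user) with mean $N_{BS}N_u$, $h_s$ (BS–RIS) with mean $N_{BS}N_R$, $h_r$ (RIS–user) with mean $N_RN_u$. The two point processes and all gains are independent, and, given the positions, the LoS states of the different links are independent of each other and of the gains. Let $\alpha\in\mathbb R$, $\beta,P_0,\sigma>0$ and $T>0$. A user at distance $\xi$ from the BS with a LoS direct link is associated with it, and its SINR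 is $\gamma=\frac{10^\alpha P_0h_d}{\xi^\beta\sigma^2}$. If the direct link is not LoS, the user is associated with the RIS of largest mean received power among those with a LoS link to the user (equivalently, that of smallest $s r$, where $s$, $r$ are the distances of the RIS to the BS and to the user), and $\gamma=\frac{10^{2\alpha}P_0h_sh_r}{(sr)^\beta\sigma^2}$; if there is no such RIS, $\gamma=0$. The user is covered if $\gamma>T$. *Claim.* Let $P^s_R(\xi)$ be the probability that a user at distance $\xi$ from the BS has at least one RIS with a LoS link to it, and let $F_{\eta|\xi}$ be the distribution function of $\eta=\min sr$ (the minimum over these RISs), conditionally on there being at least one. For $0<\xi\le R$ the probability that a user at distance $\xi$ is covered is $$P^s_{cov|\xi}(T)=P_{LoS}(\xi)\,e^{-\frac{\tau_1}{N_{BS}N_u}}+(1-P_{LoS}(\xi))\,P^s_R(\xi)\int_0^\infty\!\!\int_0^\infty F_{\eta|\xi}\big(\tau_2(x_1,x_2)\big)f_{h_s}(x_1)\,dx_1\,f_{h_r}(x_2)\,dx_2,$$ where $\tau_1=\frac{\xi^\beta\sigma^2T}{P_010^\alpha}$, $\tau_2(x_1,x_2)=\big(\frac{P_0x_1x_210^{2\alpha}}{\sigma^2T}\big)^{1/\beta}$,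 $f_{h_s}$ and $f_{h_r}$ are the densities of $h_s$ and $h_r$, and, for all $t\in\mathbb R$, $$P^s_R(\xi)=1-\exp\Big(-\int_0^{2\pi}\!\!\int_0^{\sqrt{R^2-\xi^2\sin^2\psi}-\xi\cos\psi}\lambda_RP_{LoS}(r)\,r\,dr\,d\psi\Big),$$ $$F_{\eta|\xi}(t)=\frac{1}{P^s_R(\xi)}\Big[1-\exp\Big(-\int_0^R\!\!\int_{\{\theta\in[0,2\pi]:\,s\,\rho\le t\}}\lambda_RP_{LoS}(\rho)\,s\,d\theta\,ds\Big)\Big],\qquad \rho=\sqrt{s^2+\xi^2-2s\xi\cos\theta}.$$ The mean number of users is $\int_0^R\lambda_u(\xi)2\pi\xi\,d\xi$, and the ergodic coverage probability of the cell, i.e. the mean number of covered users divided by the mean number of users, which also equals the mean of $\sum_{u}P^s_{cov|\|u\|}(T)$ over the users $u$ divided by the mean number of users, is $$E[P^s_{cov}(T)]=\frac{\int_0^RP^s_{cov|\xi}(T)\,\lambda_u(\xi)\,2\pi\xi\,d\xi}{\int_0^R\lambda_u(\xi)\,2\pi\xi\,d\xi}.$$ -/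

import Mathlib

open MeasureTheory ProbabilityTheory Set
open scoped ENNReal NNReal

noncomputable section

namespace RISCell

/-- The parameters of the cell, with their natural ranges. -/
structure Params where
  /-- cell radius -/
  R : ℝ
  /-- user density, as a function of the distance to the base station -/
  lamU : ℝ → ℝ
  /-- density of the surfaces (RISs) -/
  lamR : ℝ
  /-- density of the blockage centres -/
  lamB : ℝ
  /-- smallest and largest blockage length -/
  Lmin : ℝ
  Lmax : ℝ
  /-- large-scale fading parameters: the gain at distance `d` is `10 ^ α / d ^ β` -/
  alpha : ℝ
  beta : ℝ
  /-- transmit power and noise standard deviation -/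
  P0 : ℝ
  sigma : ℝ
  /-- numbers of antennas (base station), elements (surface), antennas (user) -/
  NBS : ℕ
  NR : ℕ
  Nu : ℕ
  R_pos : 0 < R
  lamU_meas : Measurable lamU
  lamU_nonneg : ∀ ξ ∈ Icc (0 : ℝ) R, 0 ≤ lamU ξ
  /-- the mean number of users is finite ... -/
  lamU_int : IntegrableOn (fun ξ => lamU ξ * (2 * Real.pi * ξ)) (Icc (0 : ℝ) R)
  /-- ... and nonzero -/
  lamU_pos : 0 < ∫ ξ in (0 : ℝ)..R, lamU ξ * (2 * Real.pi * ξ)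
  lamR_pos : 0 < lamR
  lamB_nonneg : 0 ≤ lamB
  Lmin_nonneg : 0 ≤ Lmin
  Lmin_le : Lmin ≤ Lmax
  beta_pos : 0 < beta
  P0_pos : 0 < P0
  sigma_pos : 0 < sigma
  NBS_pos : 0 < NBS
  NR_pos : 0 < NR
  Nu_pos : 0 < Nu

/-! ### Poisson point processes with finitely many points -/

section Poisson

variable {Ω E : Type*} [MeasurableSpace Ω] [MeasurableSpace E]

open Classical in
/-- The number of points in `B` of the random configuration `X 0, …, X (N - 1)`. -/
def count (N : Ω → ℕ) (X : ℕ → Ω → E) (B : Set E) (ω : Ω) : ℕ :=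
  ((Finset.range (N ω)).filter (fun i => X i ω ∈ B)).card

/-- The random finite configuration `X 0, …, X (N - 1)` is a Poisson point process with finite
intensity measure `Λ`: the number of points in `B` is Poisson with mean `Λ B`, and the numbers of
points in disjoint sets are independent. -/
structure IsPoissonProcess (P : Measure Ω) (N : Ω → ℕ) (X : ℕ → Ω → E) (Λ : Measure E) :
    Prop where
  finite : Λ univ < ∞
  measurable_num : Measurable N
  measurable_pos : ∀ i, Measurable (X i)
  law : ∀ B, MeasurableSet B → HasLaw (count N X B) (poissonMeasure (Λ B).toNNReal) P
  indep : ∀ (n : ℕ) (B : Fin n → Set E), (∀ k, MeasurableSet (B k)) →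
    Pairwise (fun k l => Disjoint (B k) (B l)) → iIndepFun (fun k => count N X (B k)) P

end Poisson

/-! ### The random network -/

/-- Labels of the real random variables attached to links; `i` numbers the users, `j` the
surfaces. -/
inductive Mark where
  /-- blockage variable of the direct link to user `i` -/
  | directBlock (i : ℕ)
  /-- small-scale fading gain of the direct link to user `i` -/
  | directGain (i : ℕ)
  /-- blockage variable of the link from surface `j` to user `i` -/
  | risBlock (i j : ℕ)
  /-- small-scale fading gain of the link from the base station to surface `j` -/
  | bsGain (j : ℕ)
  /-- small-scale fading gain of the link from surface `j` to user `i` -/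
  | userGain (i j : ℕ)

/-- Users, surfaces and link variables. The base station is at the origin of the plane, which is
identified with `ℂ`. -/
structure Network (Ω : Type*) where
  numUsers : Ω → ℕ
  userPos : ℕ → Ω → ℂ
  numRIS : Ω → ℕ
  risPos : ℕ → Ω → ℂ
  mark : Mark → Ω → ℝ

namespace Params

variable (p : Params)

/-- The mean length of a blockage, the length being uniform on `[Lmin, Lmax]`. -/
def meanLength : ℝ := (p.Lmin + p.Lmax) / 2

/-- The probability that a link of length `d` is line-of-sight. -/
def pLoS (d : ℝ) : ℝ := Real.exp (-(2 * p.lamB * p.meanLength * d / Real.pi))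

/-- Intensity measure of the users: density `λ_u(‖x‖)` on the disk of radius `R`. -/
def userIntensity : Measure ℂ :=
  (volume.restrict (Metric.closedBall (0 : ℂ) p.R)).withDensity
    (fun x => ENNReal.ofReal (p.lamU ‖x‖))

/-- Intensity measure of the surfaces: constant density `λ_R` on the disk of radius `R`. -/
def risIntensity : Measure ℂ :=
  ENNReal.ofReal p.lamR • volume.restrict (Metric.closedBall (0 : ℂ) p.R)

/-- The law of each link variable: a blockage variable is uniform on `[0, 1]`; a fading gain is
exponential, with mean the product of the numbers of antennas or elements at its two ends
(`expMeasure` takes the rate, the inverse of the mean). -/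
def markLaw : Mark → Measure ℝ
  | .directBlock _ => volume.restrict (Icc 0 1)
  | .directGain _ => expMeasure (1 / ((p.NBS : ℝ) * p.Nu))
  | .risBlock _ _ => volume.restrict (Icc 0 1)
  | .bsGain _ => expMeasure (1 / ((p.NBS : ℝ) * p.NR))
  | .userGain _ _ => expMeasure (1 / ((p.NR : ℝ) * p.Nu))

end Params

variable {Ω : Type*} [MeasurableSpace Ω]

/-- The probabilistic model: users and surfaces are Poisson point processes, and these two
processes and all link variables are independent. -/
structure IsModel (p : Params) (P : Measure Ω) (S : Network Ω) : Prop where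
  users : IsPoissonProcess P S.numUsers S.userPos p.userIntensity
  riss : IsPoissonProcess P S.numRIS S.risPos p.risIntensity
  measurable_mark : ∀ m, Measurable (S.mark m)
  law_mark : ∀ m, HasLaw (S.mark m) (p.markLaw m) P
  indep_marks : iIndepFun S.mark P
  indep_users_riss : IndepFun (fun ω => (S.numUsers ω, fun i => S.userPos i ω))
    (fun ω => (S.numRIS ω, fun j => S.risPos j ω)) P
  indep_points_marks : IndepFun
    (fun ω => ((S.numUsers ω, fun i => S.userPos i ω), (S.numRIS ω, fun j => S.risPos j ω)))
    (fun ω m => S.mark m ω) P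

/-! ### Links, association and coverage

Throughout, `i` is the number of a user and `x` is the place where this user is. -/

section Links

variable (p : Params) (S : Network Ω) (i : ℕ) (x : ℂ)

/-- The direct link is line-of-sight; given the positions this has probability `pLoS ‖x‖`. -/
def DirectLoS (ω : Ω) : Prop := S.mark (.directBlock i) ω ≤ p.pLoS ‖x‖

/-- Surface `j` can assist the user: its link to the user is line-of-sight, which given the
positions has probability `pLoS` of the length of that link, independently for all links. The links
between the base station and the surfaces are always line-of-sight. -/
def Assists (ω : Ω) (j : ℕ) : Prop :=
  j < S.numRIS ω ∧ S.mark (.risBlock i j) ω ≤ p.pLoS ‖S.risPos j ω - x‖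

/-- At least one reflected line-of-sight link to the user exists. -/
def HasReflected (ω : Ω) : Prop := ∃ j, Assists p S i x ω j

/-- The product `s_j * r_j` of the distances from surface `j` to the base station and to the
user. -/
def distProd (ω : Ω) (j : ℕ) : ℝ := ‖S.risPos j ω‖ * ‖S.risPos j ω - x‖

/-- `η`, the minimum of `s_j * r_j` over the surfaces that can assist the user (meaningful when
there is one). -/
def eta (ω : Ω) : ℝ := sInf (distProd S x ω '' {j | Assists p S i x ω j})

/-- SINR of the direct link. -/
def sinrDirect (ω : Ω) : ℝ :=
  (10 : ℝ) ^ p.alpha * p.P0 * S.mark (.directGain i) ω / (‖x‖ ^ p.beta * p.sigma ^ 2)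

/-- SINR of the link reflected by surface `j`. -/
def sinrReflected (ω : Ω) (j : ℕ) : ℝ :=
  (10 : ℝ) ^ (2 * p.alpha) * p.P0 * S.mark (.bsGain j) ω * S.mark (.userGain i j) ω /
    (distProd S x ω j ^ p.beta * p.sigma ^ 2)

/-- Large-scale power of the link reflected by surface `j`, the small-scale fading gains being
replaced by their means. -/
def meanPower (ω : Ω) (j : ℕ) : ℝ :=
  p.P0 * ((10 : ℝ) ^ (2 * p.alpha) / distProd S x ω j ^ p.beta) *
    (((p.NBS : ℝ) * p.NR) * ((p.NR : ℝ) * p.Nu))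

/-- Surface `j` is the one through which the user is reached when the direct link is blocked: among
the surfaces that can assist, it provides the largest mean power (ties, which have probability
zero, go to the smallest number). -/
def Associated (ω : Ω) (j : ℕ) : Prop :=
  Assists p S i x ω j ∧ ∀ k, Assists p S i x ω k →
    meanPower p S x ω k < meanPower p S x ω j ∨
      (meanPower p S x ω k = meanPower p S x ω j ∧ j ≤ k)

open Classical in
/-- SINR of the associated link: the direct link if it is line-of-sight, otherwise the reflected
link of the associated surface (at most one term of the sum is nonzero), and `0` if there is no
link. -/
def sinr (ω : Ω) : ℝ :=
  if DirectLoS p S i x ω then sinrDirect p S i x ω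
  else ∑ j ∈ Finset.range (S.numRIS ω),
    if Associated p S i x ω j then sinrReflected p S i x ω j else 0

/-- The user is covered at threshold `T`. -/
def Covered (T : ℝ) (ω : Ω) : Prop := T < sinr p S i x ω

/-- The probability that at least one reflected line-of-sight link to the user exists. -/
def reflectionProb (P : Measure Ω) : ℝ := P.real {ω | HasReflected p S i x ω}

/-- The distribution function of `η` (which presupposes a reflected line-of-sight link), that is,
conditionally on the existence of such a link. -/
def etaCDF (P : Measure Ω) (t : ℝ) : ℝ :=
  (ProbabilityTheory.cond P {ω | HasReflected p S i x ω}).real {ω | eta p S i x ω ≤ t}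

/-- The coverage probability of a user at `x`. -/
def coverageProb (P : Measure Ω) (T : ℝ) : ℝ := P.real {ω | Covered p S i x T ω}

end Links

open Classical in
/-- The number of covered users. -/
def numCovered (p : Params) (S : Network Ω) (T : ℝ) (ω : Ω) : ℕ :=
  ((Finset.range (S.numUsers ω)).filter (fun i => Covered p S i (S.userPos i ω) T ω)).card

/-- The mean number of users. -/
def meanUsers (S : Network Ω) (P : Measure Ω) : ℝ := ∫ ω, (S.numUsers ω : ℝ) ∂P

/-- The ergodic coverage probability of the cell: the mean number of covered users over the mean
number of users. -/
def ergodicCoverage (p : Params) (S : Network Ω) (P : Measure Ω) (T : ℝ) : ℝ :=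
  (∫ ω, (numCovered p S T ω : ℝ) ∂P) / meanUsers S P

/-! ### The closed forms, as functions of the distance `ξ` from the base station to the user -/

namespace Params

variable (p : Params)

/-- The distance from a user at distance `ξ` from the centre to the boundary of the cell, in the
direction that makes the angle `ψ` with the outward one. -/
def boundaryDist (ξ ψ : ℝ) : ℝ :=
  Real.sqrt (p.R ^ 2 - ξ ^ 2 * Real.sin ψ ^ 2) - ξ * Real.cos ψ

/-- The mean number of surfaces that can assist the user. -/
def meanAssisting (ξ : ℝ) : ℝ :=
  ∫ ψ in (0 : ℝ)..(2 * Real.pi), ∫ r in (0 : ℝ)..(p.boundaryDist ξ ψ), p.lamR * p.pLoS r * r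

/-- `P_R(ξ)`. -/
def PR (ξ : ℝ) : ℝ := 1 - Real.exp (-p.meanAssisting ξ)

/-- The length of the third side of a triangle with sides `s`, `ξ` enclosing the angle `θ`. -/
def thirdSide (s ξ θ : ℝ) : ℝ := Real.sqrt (s ^ 2 + ξ ^ 2 - 2 * s * ξ * Real.cos θ)

open Classical in
/-- The mean number of surfaces that can assist the user and have `s * r ≤ t`. -/
def meanAssistingLE (ξ t : ℝ) : ℝ :=
  ∫ s in (0 : ℝ)..p.R, ∫ θ in (0 : ℝ)..(2 * Real.pi),
    if s * thirdSide s ξ θ ≤ t then p.lamR * p.pLoS (thirdSide s ξ θ) * s else 0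

/-- `F_{η|ξ}(t)`. -/
def Feta (ξ t : ℝ) : ℝ := (1 - Real.exp (-p.meanAssistingLE ξ t)) / p.PR ξ

def tau1 (T ξ : ℝ) : ℝ := ξ ^ p.beta * p.sigma ^ 2 * T / (p.P0 * (10 : ℝ) ^ p.alpha)

def tau2 (T hs hr : ℝ) : ℝ :=
  (p.P0 * hs * hr * (10 : ℝ) ^ (2 * p.alpha) / (p.sigma ^ 2 * T)) ^ (1 / p.beta)

/-- The density of the exponential distribution with mean `m`. -/
def expDensity (m y : ℝ) : ℝ := if 0 < y then 1 / m * Real.exp (-(1 / m * y)) else 0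

/-- The coverage probability at distance `ξ`. -/
def Pcov (T ξ : ℝ) : ℝ :=
  p.pLoS ξ * Real.exp (-(p.tau1 T ξ / ((p.NBS : ℝ) * p.Nu))) +
    (1 - p.pLoS ξ) * p.PR ξ *
      ∫ y in Ioi (0 : ℝ), (∫ z in Ioi (0 : ℝ),
        p.Feta ξ (p.tau2 T z y) * expDensity ((p.NBS : ℝ) * p.NR) z) *
          expDensity ((p.NR : ℝ) * p.Nu) y

end Params

end RISCell

end

/-! The proof conditions on the positions of the surfaces and works with the product law
`markMeasure` of the link variables. The blockage variables are independent, so for a fixed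
configuration `w` the probability that no surface in a set `Q` assists the user is the product over
the surfaces of `1 - 1_Q * pLoS` (`markMeasure_assists`). The Laplace functional of the Poisson
process (`IsPoissonProcess.integral_prod`) turns the mean of this product into the exponential of
minus an integral over the cell. The whole plane as `Q` gives `PR`. A Cassini region as `Q` gives
the law of `eta`, since `eta ≤ t` together with the existence of a link means that some surface with
`s * r ≤ t` assists. The integrals become the stated ones in polar coordinates centred at the user
and at the base station respectively.

For coverage with a blocked direct link, which surface is associated depends only on positions and
blockages, hence not on the gains. The associated surface succeeds almost surely exactly when its `s
* r` is at most `tau2` of its two gains, and its `s * r` is the minimum. The success probability is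
therefore the mean, over an independent pair of gains `g`, of the probability that some assisting
surface lies in the Cassini region of level `tau2 g` (`markMeasure_reflected`). Fubini and the
previous computation give the double integral of `Feta` (`IsModel.integral_gain_assistProb`). An
unblocked direct link contributes an exponential tail.

For the cell average, the users are independent of surfaces and link variables, so the position of a
user may be frozen when its coverage is evaluated (`IsModel.measure_user_covered`). Campbell's
formula then converts the sum over users into an integral against the user intensity. -/

namespace RISCell

/-! ### Poisson processes: Campbell's formula and the Laplace functional. -/

section Poisson

lemma count_eq_sum {Ω E : Type*} (N : Ω → ℕ) (X : ℕ → Ω → E) (B : Set E) (ω : Ω) :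
    (count N X B ω : ℝ≥0∞) =
      ∑' j, {ω | j < N ω}.indicator (fun ω => B.indicator (fun _ => 1) (X j ω)) ω := by
  classical
  rw [tsum_eq_sum (s := Finset.range (N ω))]
  · rw [count, Finset.card_filter]
    push_cast
    refine Finset.sum_congr rfl fun j hj => ?_
    rw [indicator_of_mem (by simpa using hj)]
    simp [indicator_apply]
  · intro j hj
    exact indicator_of_notMem (by simpa using hj) _

lemma prod_range_simpleFunc {Ω E : Type*} [MeasurableSpace E] (N : Ω → ℕ) (X : ℕ → Ω → E)
    (g : SimpleFunc E ℝ) (ω : Ω) :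
    ∏ j ∈ Finset.range (N ω), g (X j ω) = ∏ c ∈ g.range, c ^ count N X (g ⁻¹' {c}) ω := by
  classical
  rw [← Finset.prod_fiberwise_of_maps_to (s := Finset.range (N ω)) (t := g.range)
    (g := fun j => g (X j ω)) (fun j _ => g.mem_range_self _)]
  refine Finset.prod_congr rfl fun c _ => ?_
  rw [Finset.prod_congr rfl (g := fun _ => c) (fun j hj => (Finset.mem_filter.1 hj).2),
    Finset.prod_const, count]
  congr!

variable {Ω E : Type*} [MeasurableSpace Ω] [MeasurableSpace E]

lemma integral_pow_poissonMeasure (r : ℝ≥0) (c : ℝ) :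
    ∫ n, c ^ n ∂(poissonMeasure r) = Real.exp (r * (c - 1)) := by
  rw [integral_poissonMeasure]
  have h := (NormedSpace.expSeries_div_hasSum_exp (r * c : ℝ)).mul_left (Real.exp (-r))
  rw [← Real.exp_eq_exp_ℝ, ← Real.exp_add] at h
  rw [show (r : ℝ) * (c - 1) = -r + r * c by ring, ← h.tsum_eq]
  refine tsum_congr fun n => ?_
  simp only [smul_eq_mul, mul_pow]
  ring

lemma lintegral_natCast_poissonMeasure (r : ℝ≥0) :
    ∫⁻ n, (n : ℝ≥0∞) ∂(poissonMeasure r) = r := by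
  rw [lintegral_countable']
  simp only [poissonMeasure_singleton]
  have h := (NormedSpace.expSeries_div_hasSum_exp (r : ℝ)).mul_left (Real.exp (-r) * r)
  rw [← Real.exp_eq_exp_ℝ, mul_right_comm, ← Real.exp_add, neg_add_cancel, Real.exp_zero,
    one_mul] at h
  have key : ∀ n : ℕ, ((n : ℝ≥0∞)) * ENNReal.ofReal (Real.exp (-r) * r ^ n / (n.factorial)) =
      ENNReal.ofReal (n * (Real.exp (-r) * r ^ n / (n.factorial))) := fun n => by
    rw [ENNReal.ofReal_mul (by positivity), ENNReal.ofReal_natCast]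
  simp only [key]
  -- The term `n = 0` vanishes, and in the others `n / n!` is `1 / (n - 1)!`: the exponential series
  -- again, times `r`.
  rw [tsum_eq_zero_add' ENNReal.summable]
  simp only [Nat.cast_zero, zero_mul, ENNReal.ofReal_zero, zero_add]
  have h' := congrArg ENNReal.ofReal h.tsum_eq
  rw [ENNReal.ofReal_tsum_of_nonneg (fun n => by positivity) h.summable,
    ENNReal.ofReal_coe_nnreal] at h'
  refine Eq.trans (tsum_congr fun n => ?_) h'
  congr 1
  rw [Nat.factorial_succ]
  push_cast
  field_simp
  ring

variable {P : Measure Ω} {N : Ω → ℕ} {X : ℕ → Ω → E} {Λ : Measure E}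

/-- **Campbell's formula**. -/
lemma IsPoissonProcess.lintegral_sum (h : IsPoissonProcess P N X Λ) {f : E → ℝ≥0∞}
    (hf : Measurable f) :
    ∑' j, ∫⁻ ω in {ω | j < N ω}, f (X j ω) ∂P = ∫⁻ x, f x ∂Λ := by
  have hN : ∀ j, MeasurableSet {ω | j < N ω} := fun j =>
    measurableSet_lt measurable_const h.measurable_num
  -- Nothing is known about the law of an individual `X j`, only about counts. But the laws of the
  -- `X j` on `{j < N}` add up to a measure whose value at `B` is the mean count of `B`, that is, `Λ
  -- B`.
  have hM : Measure.sum (fun j => (P.restrict {ω | j < N ω}).map (X j)) = Λ := by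
    ext B hB
    have : Λ B = ∫⁻ ω, (count N X B ω : ℝ≥0∞) ∂P := by
      have h1 := (h.law B hB).lintegral_comp (f := fun n : ℕ => (n : ℝ≥0∞))
        (measurable_of_countable _).aemeasurable
      rw [h1, lintegral_natCast_poissonMeasure, ENNReal.coe_toNNReal]
      exact ((measure_mono (subset_univ B)).trans_lt h.finite).ne
    rw [this, Measure.sum_apply _ hB]
    simp only [count_eq_sum]
    rw [lintegral_tsum]
    · refine tsum_congr fun j => ?_
      rw [Measure.map_apply (h.measurable_pos j) hB, lintegral_indicator (hN j)]
      have : (fun ω => B.indicator (fun _ => (1 : ℝ≥0∞)) (X j ω)) =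
        (X j ⁻¹' B).indicator (fun _ => 1) := rfl
      rw [this, lintegral_indicator ((h.measurable_pos j) hB)]
      simp
    · intro j
      refine (Measurable.indicator ?_ (hN j)).aemeasurable
      exact (measurable_const.indicator hB).comp (h.measurable_pos j)
  rw [← hM, lintegral_sum_measure]
  exact tsum_congr fun j => (lintegral_map hf (h.measurable_pos j)).symm

lemma IsPoissonProcess.lintegral_sum_range (h : IsPoissonProcess P N X Λ) {f : E → ℝ≥0∞}
    (hf : Measurable f) :
    ∫⁻ ω, ∑ j ∈ Finset.range (N ω), f (X j ω) ∂P = ∫⁻ x, f x ∂Λ := by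
  rw [← h.lintegral_sum hf]
  have hN : ∀ j, MeasurableSet {ω | j < N ω} := fun j =>
    measurableSet_lt measurable_const h.measurable_num
  simp_rw [← lintegral_indicator (hN _)]
  have hm : ∀ j, AEMeasurable ({ω | j < N ω}.indicator fun ω => f (X j ω)) P := fun j =>
    Measurable.aemeasurable (Measurable.indicator (hf.comp (h.measurable_pos j)) (hN j))
  rw [← lintegral_tsum hm]
  refine lintegral_congr fun ω => ?_
  rw [tsum_eq_sum (s := Finset.range (N ω))]
  · exact Finset.sum_congr rfl fun j hj => by
      rw [indicator_of_mem (by simpa using hj)]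
  · intro j hj
    exact indicator_of_notMem (by simpa using hj) _

/-- Campbell's formula for the indicator of `A`: a sum of nonnegative terms that vanishes has only
zero terms. -/
lemma IsPoissonProcess.ae_notMem (h : IsPoissonProcess P N X Λ) {A : Set E}
    (hA : MeasurableSet A) (hA0 : Λ A = 0) : ∀ᵐ ω ∂P, ∀ j < N ω, X j ω ∉ A := by
  have hN : ∀ j, MeasurableSet {ω | j < N ω} := fun j =>
    measurableSet_lt measurable_const h.measurable_num
  have h1 := h.lintegral_sum (f := A.indicator 1) (measurable_one.indicator hA)
  rw [lintegral_indicator_one hA, hA0, ENNReal.tsum_eq_zero] at h1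
  rw [ae_all_iff]
  intro j
  have h2 := (lintegral_eq_zero_iff ((measurable_one.indicator hA).comp (h.measurable_pos j))).1
    (h1 j)
  filter_upwards [(ae_restrict_iff' (hN j)).1 h2] with ω hω hj hX
  simpa [hX] using hω hj

lemma IsPoissonProcess.measurable_count (h : IsPoissonProcess P N X Λ) {B : Set E}
    (hB : MeasurableSet B) : Measurable (count N X B) := by
  have hN : ∀ j, MeasurableSet {ω | j < N ω} := fun j =>
    measurableSet_lt measurable_const h.measurable_num
  have h1 : Measurable fun ω => (count N X B ω : ℝ≥0∞) := by
    simp only [count_eq_sum]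
    exact Measurable.tsum fun j => Measurable.indicator
      ((measurable_const.indicator hB).comp (h.measurable_pos j)) (hN j)
  refine measurable_to_countable' fun n => ?_
  have : count N X B ⁻¹' {n} = (fun ω => (count N X B ω : ℝ≥0∞)) ⁻¹' {(n : ℝ≥0∞)} := by
    ext ω; simp
  rw [this]
  exact h1 (measurableSet_singleton _)

lemma measurable_sum_range {α : Type*} [MeasurableSpace α] {N : α → ℕ} (hN : Measurable N)
    {f : ℕ → α → ℝ} (hf : ∀ j, Measurable (f j)) :
    Measurable fun a => ∑ j ∈ Finset.range (N a), f j a := by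
  have : Measurable fun q : ℕ × α => ∑ j ∈ Finset.range q.1, f j q.2 :=
    measurable_from_prod_countable_right fun n =>
      Finset.measurable_fun_sum (Finset.range n) fun j _ => hf j
  exact this.comp (hN.prodMk measurable_id)

lemma measurable_prod_range {α : Type*} [MeasurableSpace α] {N : α → ℕ} (hN : Measurable N)
    {f : ℕ → α → ℝ} (hf : ∀ j, Measurable (f j)) :
    Measurable fun a => ∏ j ∈ Finset.range (N a), f j a := by
  have : Measurable fun q : ℕ × α => ∏ j ∈ Finset.range q.1, f j q.2 :=
    measurable_from_prod_countable_right fun n =>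
      Finset.measurable_fun_prod (Finset.range n) fun j _ => hf j
  exact this.comp (hN.prodMk measurable_id)

/-- Grouping the points by the value of `g` gives a product of powers `c ^ count`. The fibres of `g`
are disjoint, so the counts are independent and the mean is a product of Poisson generating
functions. -/
lemma IsPoissonProcess.integral_prod_simpleFunc [IsProbabilityMeasure P]
    (h : IsPoissonProcess P N X Λ) (g : SimpleFunc E ℝ) :
    ∫ ω, ∏ j ∈ Finset.range (N ω), g (X j ω) ∂P = Real.exp (-∫ x, (1 - g x) ∂Λ) := by
  have : IsFiniteMeasure Λ := ⟨h.finite⟩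
  let e := g.range.equivFin
  let B : Fin g.range.card → Set E := fun k => g ⁻¹' {(e.symm k : ℝ)}
  have hB : ∀ k, MeasurableSet (B k) := fun k => g.measurableSet_preimage _
  have hdisj : Pairwise (fun k l => Disjoint (B k) (B l)) := by
    intro k l hkl
    refine Disjoint.preimage _ ?_
    rw [disjoint_singleton]
    intro h'
    exact hkl (e.symm.injective (Subtype.ext h'))
  have hind := h.indep _ B hB hdisj
  have hprod : ∀ ω, ∏ j ∈ Finset.range (N ω), g (X j ω) =
      ∏ k, (e.symm k : ℝ) ^ count N X (B k) ω := by
    intro ω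
    rw [prod_range_simpleFunc, ← Finset.prod_coe_sort, ← e.symm.prod_comp]
  simp only [hprod]
  have := hind.integral_fun_prod_comp (f := fun k (n : ℕ) => (e.symm k : ℝ) ^ n)
    (fun k => (h.measurable_count (hB k)).aemeasurable)
    (fun k => (measurable_of_countable _).aestronglyMeasurable)
  rw [this]
  have hk : ∀ k, ∫ ω, (e.symm k : ℝ) ^ count N X (B k) ω ∂P =
      Real.exp (Λ.real (B k) * (e.symm k - 1)) := by
    intro k
    have := (h.law (B k) (hB k)).integral_comp (f := fun n : ℕ => (e.symm k : ℝ) ^ n)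
      (measurable_of_countable _).aestronglyMeasurable
    rw [integral_pow_poissonMeasure] at this
    exact this
  simp only [hk]
  rw [← Real.exp_sum]
  congr 1
  have hint : ∫ x, (1 - g x) ∂Λ = ∑ c ∈ g.range, Λ.real (g ⁻¹' {c}) * (1 - c) := by
    have hi : Integrable g Λ := g.integrable_of_isFiniteMeasure
    rw [integral_sub (integrable_const _) hi, ← SimpleFunc.integral_eq_integral g hi,
      SimpleFunc.integral_eq]
    have h1 : ∫ _, (1 : ℝ) ∂Λ = ∑ c ∈ g.range, Λ.real (g ⁻¹' {c}) := by
      rw [integral_const, smul_eq_mul, mul_one,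
        sum_measureReal_preimage_singleton _ (fun c _ => g.measurableSet_preimage _)]
      congr 1
      ext x; simp
    rw [h1, ← Finset.sum_sub_distrib]
    exact Finset.sum_congr rfl fun c _ => by simp only [smul_eq_mul]; ring
  rw [hint, ← Finset.sum_neg_distrib, ← Finset.sum_coe_sort g.range, ← e.symm.sum_comp]
  exact Finset.sum_congr rfl fun k _ => by simp only [B]; ring

/-- The Laplace functional of a Poisson process. -/
lemma IsPoissonProcess.integral_prod [IsProbabilityMeasure P]
    (h : IsPoissonProcess P N X Λ) {f : E → ℝ} (hf : Measurable f)
    (hf01 : ∀ x, f x ∈ Icc (0 : ℝ) 1) :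
    ∫ ω, ∏ j ∈ Finset.range (N ω), f (X j ω) ∂P = Real.exp (-∫ x, (1 - f x) ∂Λ) := by
  have : IsFiniteMeasure Λ := ⟨h.finite⟩
  have h0 : (0 : ℝ) ∈ Icc (0 : ℝ) 1 := by simp
  -- The approximants stay in `[0, 1]`, so all products are bounded by `1` and dominated convergence
  -- applies on both sides.
  let g := SimpleFunc.approxOn f hf (Icc 0 1) 0 h0
  have hg : ∀ n x, g n x ∈ Icc (0 : ℝ) 1 := fun n x => SimpleFunc.approxOn_mem hf h0 n x
  have hlim : ∀ x, Filter.Tendsto (fun n => g n x) Filter.atTop (nhds (f x)) := fun x =>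
    SimpleFunc.tendsto_approxOn hf h0 (subset_closure (hf01 x))
  have h1 : Filter.Tendsto (fun n => ∫ ω, ∏ j ∈ Finset.range (N ω), g n (X j ω) ∂P) Filter.atTop
      (nhds (∫ ω, ∏ j ∈ Finset.range (N ω), f (X j ω) ∂P)) := by
    refine tendsto_integral_of_dominated_convergence (fun _ => 1) (fun n => ?_)
      (integrable_const _) (fun n => ?_) ?_
    · exact (measurable_prod_range h.measurable_num fun j =>
        (g n).measurable.comp (h.measurable_pos j)).aestronglyMeasurable
    · refine Filter.Eventually.of_forall fun ω => ?_
      rw [Real.norm_eq_abs, abs_of_nonneg (Finset.prod_nonneg fun j _ => (hg n _).1)]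
      exact Finset.prod_le_one (fun j _ => (hg n _).1) fun j _ => (hg n _).2
    · exact Filter.Eventually.of_forall fun ω => tendsto_finsetProd _ fun j _ => hlim _
  have h2 : Filter.Tendsto (fun n => Real.exp (-∫ x, (1 - g n x) ∂Λ)) Filter.atTop
      (nhds (Real.exp (-∫ x, (1 - f x) ∂Λ))) := by
    refine (Real.continuous_exp.tendsto _).comp (Filter.Tendsto.neg ?_)
    refine tendsto_integral_of_dominated_convergence (fun _ => 1) (fun n => ?_)
      (integrable_const _) (fun n => ?_) ?_
    · exact (measurable_const.sub (g n).measurable).aestronglyMeasurable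
    · refine Filter.Eventually.of_forall fun x => ?_
      rw [Real.norm_eq_abs, abs_le]
      constructor <;> linarith [(hg n x).1, (hg n x).2]
    · exact Filter.Eventually.of_forall fun x => (hlim x).const_sub _
  simp only [h.integral_prod_simpleFunc] at h1
  exact tendsto_nhds_unique h1 h2

end Poisson

/-! ### Measurability of the network events, jointly in the user's place and the configuration. -/

/-- The coordinate network on the space of configurations of surfaces and link variables. -/
def coordNetwork : Network ((ℕ × (ℕ → ℂ)) × (Mark → ℝ)) where
  numUsers _ := 0
  userPos _ _ := 0
  numRIS q := q.1.1
  risPos j q := q.1.2 j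
  mark m q := q.2 m

/-- The surfaces and link variables of a network, as an element of the configuration space. -/
def Network.config {Ω : Type*} (S : Network Ω) (ω : Ω) : (ℕ × (ℕ → ℂ)) × (Mark → ℝ) :=
  ((S.numRIS ω, fun j => S.risPos j ω), fun m => S.mark m ω)

section Measurability

variable (p : Params) (i : ℕ)

lemma measurable_pLoS : Measurable p.pLoS := by unfold Params.pLoS; fun_prop

lemma pLoS_mem {d : ℝ} (hd : 0 ≤ d) : p.pLoS d ∈ Icc (0 : ℝ) 1 := by
  refine ⟨(Real.exp_pos _).le, Real.exp_le_one_iff.2 ?_⟩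
  have h1 := p.lamB_nonneg
  have h2 : 0 ≤ p.meanLength := by
    unfold Params.meanLength; linarith [p.Lmin_nonneg, p.Lmin_le]
  have := Real.pi_pos
  simp only [Left.neg_nonpos_iff]
  positivity

lemma measurable_coord_mark (m : Mark) :
    Measurable fun y : ℂ × (ℕ × (ℕ → ℂ)) × (Mark → ℝ) => coordNetwork.mark m y.2 :=
  (measurable_pi_apply m).comp (measurable_snd.comp measurable_snd)

lemma measurable_coord_risPos (j : ℕ) :
    Measurable fun y : ℂ × (ℕ × (ℕ → ℂ)) × (Mark → ℝ) => coordNetwork.risPos j y.2 :=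
  (measurable_pi_apply j).comp (measurable_snd.comp (measurable_fst.comp measurable_snd))

lemma measurable_coord_numRIS :
    Measurable fun y : ℂ × (ℕ × (ℕ → ℂ)) × (Mark → ℝ) => coordNetwork.numRIS y.2 :=
  measurable_fst.comp (measurable_fst.comp measurable_snd)

lemma measurable_coord_distProd (j : ℕ) :
    Measurable fun y : ℂ × (ℕ × (ℕ → ℂ)) × (Mark → ℝ) => distProd coordNetwork y.1 y.2 j := by
  unfold distProd
  have := measurable_coord_risPos j
  fun_prop

lemma measurableSet_directLoS :
    MeasurableSet {y : ℂ × (ℕ × (ℕ → ℂ)) × (Mark → ℝ) | DirectLoS p coordNetwork i y.1 y.2} :=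
  measurableSet_le (measurable_coord_mark _) ((measurable_pLoS p).comp measurable_fst.norm)

lemma measurableSet_assists (j : ℕ) :
    MeasurableSet {y : ℂ × (ℕ × (ℕ → ℂ)) × (Mark → ℝ) | Assists p coordNetwork i y.1 y.2 j} :=
  (measurableSet_lt measurable_const measurable_coord_numRIS).inter
    (measurableSet_le (measurable_coord_mark _)
      ((measurable_pLoS p).comp ((measurable_coord_risPos j).sub measurable_fst).norm))

lemma measurable_meanPower (j : ℕ) :
    Measurable fun y : ℂ × (ℕ × (ℕ → ℂ)) × (Mark → ℝ) => meanPower p coordNetwork y.1 y.2 j := by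
  unfold meanPower
  have := measurable_coord_distProd j
  fun_prop

lemma measurableSet_associated (j : ℕ) :
    MeasurableSet {y : ℂ × (ℕ × (ℕ → ℂ)) × (Mark → ℝ) | Associated p coordNetwork i y.1 y.2 j} := by
  refine (measurableSet_assists p i j).inter ?_
  refine measurableSet_setOfPred.2 (Measurable.forall fun k => ?_)
  refine Measurable.imp (measurableSet_setOfPred.1 (measurableSet_assists p i k)) ?_
  refine Measurable.or (measurableSet_setOfPred.1 ?_) (Measurable.and (measurableSet_setOfPred.1 ?_) ?_)
  · exact measurableSet_lt (measurable_meanPower p k) (measurable_meanPower p j)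
  · exact measurableSet_eq_fun (measurable_meanPower p k) (measurable_meanPower p j)
  · exact measurable_const

lemma measurable_sinrDirect :
    Measurable fun y : ℂ × (ℕ × (ℕ → ℂ)) × (Mark → ℝ) =>
      sinrDirect p coordNetwork i y.1 y.2 := by
  unfold sinrDirect
  have := measurable_coord_mark (.directGain i)
  fun_prop

lemma measurable_sinrReflected (j : ℕ) :
    Measurable fun y : ℂ × (ℕ × (ℕ → ℂ)) × (Mark → ℝ) =>
      sinrReflected p coordNetwork i y.1 y.2 j := by
  unfold sinrReflected
  have := measurable_coord_mark (.bsGain j)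
  have := measurable_coord_mark (.userGain i j)
  have := measurable_coord_distProd j
  fun_prop

lemma measurable_sinr :
    Measurable fun y : ℂ × (ℕ × (ℕ → ℂ)) × (Mark → ℝ) => sinr p coordNetwork i y.1 y.2 := by
  classical
  unfold sinr
  refine Measurable.ite (measurableSet_directLoS p i) (measurable_sinrDirect p i) ?_
  refine measurable_sum_range measurable_coord_numRIS fun j => ?_
  exact Measurable.ite (measurableSet_associated p i j) (measurable_sinrReflected p i j)
    measurable_const

lemma measurableSet_covered (T : ℝ) :
    MeasurableSet {y : ℂ × (ℕ × (ℕ → ℂ)) × (Mark → ℝ) | Covered p coordNetwork i y.1 T y.2} :=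
  measurableSet_lt measurable_const (measurable_sinr p i)

end Measurability

/-! ### Association and the minimum of `s * r`, outcome by outcome. -/

section Deterministic

variable {Ω : Type*} {p : Params} {S : Network Ω} {i : ℕ} {x : ℂ} {ω : Ω}

lemma Associated.unique {j k : ℕ} (hj : Associated p S i x ω j) (hk : Associated p S i x ω k) :
    j = k := by
  rcases hj.2 k hk.1 with h1 | ⟨h1, h1'⟩ <;> rcases hk.2 j hj.1 with h2 | ⟨h2, h2'⟩
  · linarith
  · linarith
  · linarith
  · omega

/-- Finitely many surfaces can assist: take the smallest index among the maximizers of the mean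
power. -/
lemma HasReflected.exists_associated (h : HasReflected p S i x ω) :
    ∃ j, Associated p S i x ω j := by
  classical
  let A := (Finset.range (S.numRIS ω)).filter (Assists p S i x ω)
  have hA : ∀ k, Assists p S i x ω k → k ∈ A := fun k hk =>
    Finset.mem_filter.2 ⟨Finset.mem_range.2 hk.1, hk⟩
  obtain ⟨j0, hj0⟩ := h
  obtain ⟨m, hm, hmax⟩ := A.exists_max_image (meanPower p S x ω) ⟨j0, hA _ hj0⟩
  let B := A.filter (fun k => meanPower p S x ω k = meanPower p S x ω m)
  obtain ⟨j, hj, hmin⟩ := B.exists_min_image id ⟨m, Finset.mem_filter.2 ⟨hm, rfl⟩⟩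
  have hj' := Finset.mem_filter.1 hj
  refine ⟨j, (Finset.mem_filter.1 hj'.1).2, fun k hk => ?_⟩
  rcases (hmax k (hA k hk)).lt_or_eq with hlt | heq
  · exact Or.inl (hj'.2 ▸ hlt)
  · exact Or.inr ⟨heq.trans hj'.2.symm, hmin k (Finset.mem_filter.2 ⟨hA k hk, heq⟩)⟩

/-- Mean power decreases in `s * r` as long as the latter is positive. At `s * r = 0` division by
zero would give mean power `0`, so positivity is needed; it holds almost surely by
`IsModel.ae_distProd_pos`. -/
lemma Associated.distProd_le {j k : ℕ} (hj : Associated p S i x ω j) (hk : Assists p S i x ω k)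
    (hpos : 0 < distProd S x ω j) (hpos' : 0 < distProd S x ω k) :
    distProd S x ω j ≤ distProd S x ω k := by
  have h : meanPower p S x ω k ≤ meanPower p S x ω j := by
    rcases hj.2 k hk with h | h
    exacts [h.le, h.1.le]
  have hc : 0 < ((p.NBS : ℝ) * p.NR) * ((p.NR : ℝ) * p.Nu) := by
    have := p.NBS_pos; have := p.NR_pos; have := p.Nu_pos
    positivity
  have h10 : (0 : ℝ) < (10 : ℝ) ^ (2 * p.alpha) := by positivity
  have h1 := le_of_mul_le_mul_left (le_of_mul_le_mul_right h hc) p.P0_pos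
  have h2 := (div_le_div_iff_of_pos_left h10 (Real.rpow_pos_of_pos hpos' p.beta)
    (Real.rpow_pos_of_pos hpos p.beta)).1 h1
  exact (Real.rpow_le_rpow_iff hpos.le hpos'.le p.beta_pos).1 h2

lemma exists_assists_distProd_le_iff {t : ℝ}
    (hpos : ∀ j < S.numRIS ω, 0 < distProd S x ω j) :
    (∃ j, Assists p S i x ω j ∧ distProd S x ω j ≤ t) ↔
      ∃ j, Associated p S i x ω j ∧ distProd S x ω j ≤ t := by
  constructor
  · rintro ⟨k, hk, hkt⟩
    obtain ⟨j, hj⟩ := HasReflected.exists_associated ⟨k, hk⟩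
    exact ⟨j, hj, (hj.distProd_le hk (hpos j hj.1.1) (hpos k hk.1)).trans hkt⟩
  · rintro ⟨j, hj, hjt⟩
    exact ⟨j, hj.1, hjt⟩

/-- The set of assisting surfaces is finite, so the infimum defining `eta` is attained. -/
lemma hasReflected_and_eta_le_iff {t : ℝ} :
    (HasReflected p S i x ω ∧ eta p S i x ω ≤ t) ↔
      ∃ j, Assists p S i x ω j ∧ distProd S x ω j ≤ t := by
  have hfin : {j | Assists p S i x ω j}.Finite :=
    (finite_Iio (S.numRIS ω)).subset fun j hj => hj.1
  have hfin' := hfin.image (distProd S x ω)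
  constructor
  · rintro ⟨⟨j0, hj0⟩, ht⟩
    obtain ⟨j, hj, hje⟩ := Set.Nonempty.csInf_mem (s := distProd S x ω '' {j | Assists p S i x ω j})
      ⟨_, j0, hj0, rfl⟩ hfin'
    exact ⟨j, hj, hje.trans_le ht⟩
  · rintro ⟨j, hj, hjt⟩
    exact ⟨⟨j, hj⟩, (csInf_le hfin'.bddBelow ⟨j, hj, rfl⟩).trans hjt⟩

lemma covered_iff_of_not_directLoS {T : ℝ} (hT : 0 < T) (h : ¬ DirectLoS p S i x ω) :
    Covered p S i x T ω ↔ ∃ j, Associated p S i x ω j ∧ T < sinrReflected p S i x ω j := by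
  classical
  unfold Covered sinr
  rw [if_neg h]
  by_cases hA : ∃ j, Associated p S i x ω j
  · obtain ⟨j, hj⟩ := hA
    rw [Finset.sum_eq_single_of_mem j (Finset.mem_range.2 hj.1.1), if_pos hj]
    · exact ⟨fun hs => ⟨j, hj, hs⟩, fun ⟨k, hk, hs⟩ => by rwa [hj.unique hk]⟩
    · intro k _ hkj
      exact if_neg fun hk => hkj (hk.unique hj)
  · rw [Finset.sum_eq_zero fun k _ => if_neg fun hk => hA ⟨k, hk⟩]
    exact ⟨fun hs => absurd hs hT.not_gt, fun ⟨k, hk, _⟩ => absurd ⟨k, hk⟩ hA⟩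

lemma covered_iff_of_directLoS {T : ℝ} (h : DirectLoS p S i x ω) :
    Covered p S i x T ω ↔ T < sinrDirect p S i x ω := by
  unfold Covered sinr
  rw [if_pos h]

end Deterministic

/-! ### Independence of disjoint subfamilies. -/

section Independence

lemma comap_pi_le_iSup_range {Ω ι κ : Type*} {f : ι → Ω → ℝ} (e : κ → ι) :
    MeasurableSpace.comap (fun ω k => f (e k) ω) MeasurableSpace.pi ≤
      ⨆ m ∈ range e, MeasurableSpace.comap (f m) inferInstance := by
  rw [← measurable_iff_comap_le, @measurable_pi_iff]
  intro k
  refine Measurable.mono (comap_measurable (f (e k))) ?_ le_rfl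
  exact le_iSup₂ (f := fun m (_ : m ∈ range e) =>
    MeasurableSpace.comap (f m) inferInstance) (e k) (mem_range_self k)

variable {Ω ι : Type*} [MeasurableSpace Ω] {μ : Measure Ω} {f : ι → Ω → ℝ}

/-- Each subfamily generates a σ-algebra inside the supremum over its set of labels, and suprema
over disjoint label sets are independent. -/
lemma iIndepFun_indepFun_comp_of_disjoint {κ κ' : Type*}
    (h : iIndepFun f μ) (hf : ∀ m, Measurable (f m)) (e : κ → ι) (e' : κ' → ι)
    (hd : ∀ k l, e k ≠ e' l) :
    IndepFun (fun ω k => f (e k) ω) (fun ω l => f (e' l) ω) μ := by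
  have hdis : Disjoint (range e) (range e') := by
    rw [Set.disjoint_left]
    rintro _ ⟨k, rfl⟩ ⟨l, hl⟩
    exact hd k l hl.symm
  have hI := indep_iSup_of_disjoint (fun m => (hf m).comap_le) h.iIndep hdis
  rw [IndepFun_iff_Indep]
  exact indep_of_indep_of_le_right (indep_of_indep_of_le_left hI (comap_pi_le_iSup_range e))
    (comap_pi_le_iSup_range e')

end Independence

/-! ### Exponential and uniform laws. -/

section Exponential

variable {r : ℝ}

lemma expMeasure_real_Ioi (hr : 0 < r) {x : ℝ} (hx : 0 ≤ x) :
    (expMeasure r).real (Ioi x) = Real.exp (-(r * x)) := by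
  have := isProbabilityMeasure_expMeasure hr
  have h := cdf_expMeasure_eq hr x
  rw [cdf_eq_real, if_pos hx] at h
  rw [← compl_Iic, probReal_compl_eq_one_sub measurableSet_Iic, h]
  ring

lemma ae_expMeasure_pos (hr : 0 < r) : ∀ᵐ z ∂(expMeasure r), 0 < z := by
  have := isProbabilityMeasure_expMeasure hr
  have h := expMeasure_real_Ioi hr le_rfl
  rw [mul_zero, neg_zero, Real.exp_zero] at h
  have := (mem_ae_iff_prob_eq_one (μ := expMeasure r) measurableSet_Ioi).2
    ((ENNReal.toReal_eq_one_iff _).1 h)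
  exact this

lemma expMeasure_singleton (z : ℝ) : expMeasure r {z} = 0 :=
  withDensity_absolutelyContinuous volume _ (by simp)

lemma integral_expMeasure {m : ℝ} (hm : 0 < m) (g : ℝ → ℝ) :
    ∫ z, g z ∂(expMeasure (1 / m)) = ∫ z in Ioi (0 : ℝ), g z * Params.expDensity m z := by
  have hr : 0 < 1 / m := by positivity
  have h1 : expMeasure (1 / m) =
      volume.withDensity (fun z => ENNReal.ofReal (exponentialPDFReal (1 / m) z)) := rfl
  rw [h1, integral_withDensity_eq_integral_toReal_smul₀
    (measurable_exponentialPDFReal _).ennreal_ofReal.aemeasurable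
    (Filter.Eventually.of_forall fun _ => ENNReal.ofReal_lt_top)]
  rw [← integral_indicator measurableSet_Ioi]
  refine integral_congr_ae ?_
  -- The two versions of the density differ at `0` only.
  have h0 : ∀ᵐ z : ℝ, z ≠ 0 := by
    simp [ae_iff]
  filter_upwards [h0] with z hz
  rw [ENNReal.toReal_ofReal (exponentialPDFReal_nonneg hr z), smul_eq_mul, mul_comm]
  by_cases hz' : 0 < z
  · rw [indicator_of_mem (by exact hz')]
    simp [exponentialPDFReal, gammaPDFReal, Params.expDensity, hz', hz'.le]
  · have : ¬ 0 ≤ z := fun h => hz' (lt_of_le_of_ne h hz.symm)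
    rw [indicator_of_notMem (by exact hz')]
    simp [exponentialPDFReal, gammaPDFReal, this]

end Exponential

lemma uniform_real_Iic {a : ℝ} (ha : a ∈ Icc (0 : ℝ) 1) :
    (volume.restrict (Icc (0 : ℝ) 1)).real (Iic a) = a := by
  rw [measureReal_restrict_apply measurableSet_Iic]
  have : Iic a ∩ Icc (0 : ℝ) 1 = Icc 0 a := by
    ext z
    simp only [mem_inter_iff, mem_Iic, mem_Icc]
    exact ⟨fun h => ⟨h.2.1, h.1⟩, fun h => ⟨h.2, h.1, h.2.trans ha.2⟩⟩
  rw [this, Real.volume_real_Icc_of_le ha.1, sub_zero]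

/-! ### The product law of the link variables. -/

section MarkLaw

variable (p : Params)

lemma rate_pos {m n : ℕ} (hm : 0 < m) (hn : 0 < n) : (0 : ℝ) < 1 / ((m : ℝ) * n) := by
  positivity

instance isProbabilityMeasure_markLaw (m : Mark) : IsProbabilityMeasure (p.markLaw m) := by
  cases m
  case directGain => exact isProbabilityMeasure_expMeasure (rate_pos p.NBS_pos p.Nu_pos)
  case bsGain => exact isProbabilityMeasure_expMeasure (rate_pos p.NBS_pos p.NR_pos)
  case userGain => exact isProbabilityMeasure_expMeasure (rate_pos p.NR_pos p.Nu_pos)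
  all_goals exact ⟨by simp [Params.markLaw]⟩

/-- The joint law of all link variables. -/
noncomputable def Params.markMeasure : Measure (Mark → ℝ) := Measure.infinitePi p.markLaw

instance : IsProbabilityMeasure p.markMeasure := by
  unfold Params.markMeasure; infer_instance

/-- The joint law of the gains of the two hops of a reflected link. -/
noncomputable def Params.gainMeasure : Measure (ℝ × ℝ) :=
  (expMeasure (1 / ((p.NBS : ℝ) * p.NR))).prod (expMeasure (1 / ((p.NR : ℝ) * p.Nu)))

instance : IsProbabilityMeasure p.gainMeasure := by
  have := isProbabilityMeasure_expMeasure (rate_pos p.NBS_pos p.NR_pos)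
  have := isProbabilityMeasure_expMeasure (rate_pos p.NR_pos p.Nu_pos)
  unfold Params.gainMeasure; infer_instance

lemma hasLaw_eval_mark (m : Mark) : HasLaw (fun v : Mark → ℝ => v m) (p.markLaw m) p.markMeasure :=
  ⟨(measurable_pi_apply m).aemeasurable, Measure.infinitePi_map_eval p.markLaw m⟩

lemma iIndepFun_eval_mark : iIndepFun (fun (m : Mark) (v : Mark → ℝ) => v m) p.markMeasure :=
  iIndepFun_infinitePi (P := p.markLaw) (X := fun _ z => z) (fun _ => measurable_id)

lemma hasLaw_gains (i j : ℕ) :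
    HasLaw (fun v : Mark → ℝ => (v (.bsGain j), v (.userGain i j))) p.gainMeasure
      p.markMeasure := by
  have h := (iIndepFun_eval_mark p).indepFun (i := .bsGain j) (j := .userGain i j) (by simp)
  refine ⟨by fun_prop, ?_⟩
  have h1 := hasLaw_eval_mark p (.bsGain j)
  have h2 := hasLaw_eval_mark p (.userGain i j)
  rw [h.map_prod_eq_prod_map_map h1.aemeasurable h2.aemeasurable, h1.map_eq, h2.map_eq]
  rfl

/-- The probability that one of finitely many links, of those selected by `q`, is unblocked. -/
lemma markMeasure_exists_block_le (i n : ℕ) {a : ℕ → ℝ} (ha : ∀ j, a j ∈ Icc (0 : ℝ) 1)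
    (q : ℕ → Prop) [DecidablePred q] :
    p.markMeasure.real {v | ∃ j < n, v (.risBlock i j) ≤ a j ∧ q j} =
      1 - ∏ j ∈ Finset.range n, (1 - if q j then a j else 0) := by
  have hind := (iIndepFun_eval_mark p).precomp (g := fun j => Mark.risBlock i j)
    (fun j k h => by simpa using h)
  -- The complement says that every selected link is blocked; an index that is not selected carries
  -- the void constraint `univ`.
  let s : ℕ → Set ℝ := fun j => if q j then Ioi (a j) else univ
  have hs : ∀ j, MeasurableSet (s j) := fun j => by
    by_cases hq : q j <;> simp [s, hq]
  have h := hind.measure_inter_preimage_eq_mul (Finset.range n) (sets := s) fun j _ => hs j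
  have hcompl : {v : Mark → ℝ | ∃ j < n, v (.risBlock i j) ≤ a j ∧ q j} =
      (⋂ j ∈ Finset.range n, (fun v : Mark → ℝ => v (.risBlock i j)) ⁻¹' s j)ᶜ := by
    ext v
    simp only [mem_ofPred_eq, mem_compl_iff, mem_iInter, not_forall, Finset.mem_range, mem_preimage,
      exists_prop, s]
    refine exists_congr fun j => and_congr_right fun _ => ?_
    by_cases hq : q j <;> simp [hq]
  have hm : MeasurableSet (⋂ j ∈ Finset.range n, (fun v : Mark → ℝ => v (.risBlock i j)) ⁻¹' s j) :=
    Finset.measurableSet_biInter _ fun j _ => measurable_pi_apply _ (hs j)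
  rw [hcompl, probReal_compl_eq_one_sub hm, measureReal_def, h, ENNReal.toReal_prod]
  congr 1
  refine Finset.prod_congr rfl fun j _ => ?_
  by_cases hq : q j
  · have h1 := (hasLaw_eval_mark p (.risBlock i j)).measureReal_eq (p := fun z => z ∈ Iic (a j))
      measurableSet_Iic
    have h2 : (p.markLaw (.risBlock i j)).real {z | z ∈ Iic (a j)} = a j :=
      uniform_real_Iic (ha j)
    rw [if_pos hq]
    have h3 : (fun v : Mark → ℝ => v (.risBlock i j)) ⁻¹' s j =
        {v | v (.risBlock i j) ∈ Iic (a j)}ᶜ := by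
      ext v; simp [s, hq]
    have h4 : MeasurableSet {v : Mark → ℝ | v (.risBlock i j) ∈ Iic (a j)} :=
      measurable_pi_apply _ measurableSet_Iic
    rw [← measureReal_def, h3, probReal_compl_eq_one_sub h4, h1, h2]
  · simp [s, hq]

end MarkLaw

/-! ### The SINR threshold in terms of the gains. -/

section Threshold

variable (p : Params)

lemma lt_sinrDirect_iff {T ξ h : ℝ} (hξ : 0 < ξ) :
    T < (10 : ℝ) ^ p.alpha * p.P0 * h / (ξ ^ p.beta * p.sigma ^ 2) ↔ p.tau1 T ξ < h := by
  have h1 := p.P0_pos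
  have h2 := p.sigma_pos
  have h3 : (0 : ℝ) < 10 ^ p.alpha := by positivity
  have h4 : 0 < ξ ^ p.beta := Real.rpow_pos_of_pos hξ _
  unfold Params.tau1
  rw [lt_div_iff₀ (by positivity), div_lt_iff₀ (by positivity)]
  constructor <;> intro h <;> nlinarith

/-- The value of the product of two gains at which a reflected link with product of distances `d`
reaches the threshold. -/
noncomputable def Params.criticalGain (T d : ℝ) : ℝ :=
  d ^ p.beta * (p.sigma ^ 2 * T) / (p.P0 * (10 : ℝ) ^ (2 * p.alpha))

lemma lt_sinrReflected_iff {T d z y : ℝ} (hd : 0 < d) :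
    T < (10 : ℝ) ^ (2 * p.alpha) * p.P0 * z * y / (d ^ p.beta * p.sigma ^ 2) ↔
      p.criticalGain T d < z * y := by
  have h1 := p.P0_pos
  have h2 := p.sigma_pos
  have h3 : (0 : ℝ) < 10 ^ (2 * p.alpha) := by positivity
  have h4 : 0 < d ^ p.beta := Real.rpow_pos_of_pos hd _
  unfold Params.criticalGain
  rw [lt_div_iff₀ (by positivity), div_lt_iff₀ (by positivity)]
  constructor <;> intro h <;> nlinarith

lemma le_tau2_iff {T d z y : ℝ} (hT : 0 < T) (hd : 0 < d) (hz : 0 < z) (hy : 0 < y) :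
    d ≤ p.tau2 T z y ↔ p.criticalGain T d ≤ z * y := by
  have h1 := p.P0_pos
  have h2 := p.sigma_pos
  have h3 : (0 : ℝ) < 10 ^ (2 * p.alpha) := by positivity
  unfold Params.criticalGain Params.tau2
  rw [one_div, Real.le_rpow_inv_iff_of_pos hd.le (by positivity) p.beta_pos,
    le_div_iff₀ (by positivity), div_le_iff₀ (by positivity)]
  constructor <;> intro h <;> nlinarith

lemma measurable_tau2 (T : ℝ) : Measurable fun g : ℝ × ℝ => p.tau2 T g.1 g.2 := by
  unfold Params.tau2
  fun_prop

lemma ae_gainMeasure_pos : ∀ᵐ g ∂p.gainMeasure, 0 < g.1 ∧ 0 < g.2 := by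
  have := isProbabilityMeasure_expMeasure (rate_pos p.NBS_pos p.NR_pos)
  have := isProbabilityMeasure_expMeasure (rate_pos p.NR_pos p.Nu_pos)
  refine Filter.Eventually.and ?_ ?_
  · exact Measure.quasiMeasurePreserving_fst.ae (ae_expMeasure_pos (rate_pos p.NBS_pos p.NR_pos))
  · exact Measure.quasiMeasurePreserving_snd.ae (ae_expMeasure_pos (rate_pos p.NR_pos p.Nu_pos))

lemma ae_gainMeasure_mul_ne (c : ℝ) : ∀ᵐ g ∂p.gainMeasure, g.1 * g.2 ≠ c := by
  have := isProbabilityMeasure_expMeasure (rate_pos p.NBS_pos p.NR_pos)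
  have := isProbabilityMeasure_expMeasure (rate_pos p.NR_pos p.Nu_pos)
  have hm : MeasurableSet {g : ℝ × ℝ | g.1 * g.2 ≠ c} :=
    (measurableSet_eq_fun (measurable_fst.mul measurable_snd) measurable_const).compl
  unfold Params.gainMeasure
  rw [Measure.ae_prod_iff_ae_ae hm]
  filter_upwards [ae_expMeasure_pos (rate_pos p.NBS_pos p.NR_pos)] with z hz
  have : ∀ᵐ y ∂(expMeasure (1 / ((p.NR : ℝ) * p.Nu))), y ≠ c / z := by
    rw [ae_iff]
    simpa using expMeasure_singleton (c / z)
  filter_upwards [this] with y hy h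
  exact hy ((eq_div_iff hz.ne').2 (by rw [mul_comm]; exact h))

/-- For positive gains both events compare their product with `criticalGain`, one strictly and one
not; equality has probability zero. -/
lemma gainMeasure_lt_sinrReflected {T d : ℝ} (hT : 0 < T) (hd : 0 < d) :
    p.gainMeasure.real {g | T < (10 : ℝ) ^ (2 * p.alpha) * p.P0 * g.1 * g.2 /
        (d ^ p.beta * p.sigma ^ 2)} = p.gainMeasure.real {g | d ≤ p.tau2 T g.1 g.2} := by
  refine measureReal_congr ?_
  filter_upwards [ae_gainMeasure_pos p, ae_gainMeasure_mul_ne p (p.criticalGain T d)] with g hg hne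
  refine propext ?_
  change T < _ ↔ d ≤ _
  rw [lt_sinrReflected_iff p hd, le_tau2_iff p hT hd hg.1 hg.2]
  exact ⟨le_of_lt, fun h => lt_of_le_of_ne h hne.symm⟩

end Threshold

/-! ### Probabilities given the positions of the surfaces. -/

section Conditional

variable (p : Params) (i : ℕ) (x : ℂ)

/-- The points `y` of the plane with `‖y‖ * ‖y - x‖ ≤ t`, bounded by a Cassini oval. -/
def cassini (t : ℝ) : Set ℂ := {y | ‖y‖ * ‖y - x‖ ≤ t}

lemma measurableSet_cassini (t : ℝ) : MeasurableSet (cassini x t) :=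
  measurableSet_le (by fun_prop) measurable_const

/-- The probability that, of the surfaces of the configuration `w` that lie in `Q`, at least one has
a line-of-sight link to `x`. -/
noncomputable def Params.assistProb (Q : Set ℂ) (w : ℕ × (ℕ → ℂ)) : ℝ :=
  1 - ∏ j ∈ Finset.range w.1, (1 - Q.indicator (fun y => p.pLoS ‖y - x‖) (w.2 j))

lemma markMeasure_assists (Q : Set ℂ) (w : ℕ × (ℕ → ℂ)) :
    p.markMeasure.real {v | ∃ j, Assists p coordNetwork i x (w, v) j ∧ w.2 j ∈ Q} =
      p.assistProb x Q w := by
  classical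
  have h := markMeasure_exists_block_le p i w.1 (a := fun j => p.pLoS ‖w.2 j - x‖)
    (fun j => pLoS_mem p (norm_nonneg _)) (fun j => w.2 j ∈ Q)
  rw [Params.assistProb]
  simp only [indicator_apply]
  rw [← h]
  congr 1
  ext v
  exact exists_congr fun j => and_assoc

lemma measurableSet_section {A : Set (ℂ × (ℕ × (ℕ → ℂ)) × (Mark → ℝ))} (hA : MeasurableSet A)
    (w : ℕ × (ℕ → ℂ)) : MeasurableSet {v : Mark → ℝ | (x, w, v) ∈ A} :=
  (measurable_const.prodMk (measurable_const.prodMk measurable_id)) hA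

lemma measureReal_iUnion_of_lt {α : Type*} [MeasurableSpace α] (μ : Measure α)
    [IsFiniteMeasure μ] {A : ℕ → Set α} {n : ℕ} (hA : ∀ j, MeasurableSet (A j))
    (hd : Pairwise (fun j k => Disjoint (A j) (A k))) (hn : ∀ j, (A j).Nonempty → j < n) :
    μ.real (⋃ j, A j) = ∑ j ∈ Finset.range n, μ.real (A j) := by
  have : ⋃ j, A j = ⋃ j ∈ Finset.range n, A j := by
    ext a
    simp only [mem_iUnion, Finset.mem_range, exists_prop]
    exact exists_congr fun j => ⟨fun h => ⟨hn j ⟨a, h⟩, h⟩, fun h => h.2⟩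
  rw [this, measureReal_biUnion_finset (fun j _ k _ hjk => hd hjk) (fun j _ => hA j)]

/-- Some assisting surface lies in the Cassini region exactly when the associated one does, and at
most one surface is associated. The point of this form is that `t` enters only through the
indicators, so it can be replaced by a function of the gains and integrated. -/
lemma assistProb_cassini_eq_sum (w : ℕ × (ℕ → ℂ)) (hpos : ∀ j < w.1, 0 < ‖w.2 j‖ * ‖w.2 j - x‖)
    (t : ℝ) :
    p.assistProb x (cassini x t) w = ∑ j ∈ Finset.range w.1,
      p.markMeasure.real {v | Associated p coordNetwork i x (w, v) j} *
        {t : ℝ | ‖w.2 j‖ * ‖w.2 j - x‖ ≤ t}.indicator 1 t := by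
  rw [← markMeasure_assists p i]
  have h1 : {v | ∃ j, Assists p coordNetwork i x (w, v) j ∧ w.2 j ∈ cassini x t} =
      ⋃ j, {v | Associated p coordNetwork i x (w, v) j ∧ ‖w.2 j‖ * ‖w.2 j - x‖ ≤ t} := by
    ext v
    rw [mem_iUnion]
    exact exists_assists_distProd_le_iff (S := coordNetwork) (ω := (w, v)) hpos
  have hm := fun j => measurableSet_section x (measurableSet_associated p i j) w
  rw [h1, measureReal_iUnion_of_lt p.markMeasure (n := w.1)]
  · refine Finset.sum_congr rfl fun j _ => ?_
    by_cases hj : ‖w.2 j‖ * ‖w.2 j - x‖ ≤ t <;> simp [hj]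
  · exact fun j => (hm j).inter (MeasurableSet.const _)
  · intro j k hjk
    rw [Set.disjoint_left]
    exact fun v hj hk => hjk (hj.1.unique hk.1)
  · rintro j ⟨v, hv⟩
    exact hv.1.1.1

/-- The family of link variables given by `u` on the reflected links, the other variables being
`0`. -/
def reflectedMarks (u : ℕ ⊕ ℕ ⊕ ℕ → ℝ) : Mark → ℝ
  | .risBlock _ j => u (.inl j)
  | .bsGain j => u (.inr (.inl j))
  | .userGain _ j => u (.inr (.inr j))
  | _ => 0

/-- The labels of the variables of the reflected links to user `i`. -/
def reflectedLabel : ℕ ⊕ ℕ ⊕ ℕ → Mark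
  | .inl j => .risBlock i j
  | .inr (.inl j) => .bsGain j
  | .inr (.inr j) => .userGain i j

lemma measurable_reflectedMarks : Measurable reflectedMarks := by
  refine measurable_pi_iff.2 fun m => ?_
  cases m <;> simp only [reflectedMarks] <;> fun_prop

/-- Split according to the associated surface `j`. Association and gains are independent, and the
gains of every `j` have the same law `gainMeasure`, so the sum goes under one integral over `g`,
where `assistProb_cassini_eq_sum` recombines it. -/
lemma markMeasure_reflected {T : ℝ} (hT : 0 < T) (w : ℕ × (ℕ → ℂ))
    (hpos : ∀ j < w.1, 0 < ‖w.2 j‖ * ‖w.2 j - x‖) :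
    p.markMeasure.real {v | ∃ j, Associated p coordNetwork i x (w, v) j ∧
        T < sinrReflected p coordNetwork i x (w, v) j} =
      ∫ g, p.assistProb x (cassini x (p.tau2 T g.1 g.2)) w ∂p.gainMeasure := by
  have hmA := fun j => measurableSet_section x (measurableSet_associated p i j) w
  have hmB := fun j => measurableSet_section x
    (measurableSet_lt (measurable_const (a := T)) (measurable_sinrReflected p i j)) w
  have h1 : {v | ∃ j, Associated p coordNetwork i x (w, v) j ∧
      T < sinrReflected p coordNetwork i x (w, v) j} =
      ⋃ j, {v | Associated p coordNetwork i x (w, v) j ∧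
        T < sinrReflected p coordNetwork i x (w, v) j} := by
    ext v; simp
  have hmt : ∀ j, MeasurableSet {g : ℝ × ℝ | ‖w.2 j‖ * ‖w.2 j - x‖ ≤ p.tau2 T g.1 g.2} :=
    fun j => measurableSet_le measurable_const (measurable_tau2 p T)
  rw [h1, measureReal_iUnion_of_lt p.markMeasure (n := w.1)]
  · simp only [assistProb_cassini_eq_sum p i x w hpos]
    have hI : ∀ j, (fun g : ℝ × ℝ => {t : ℝ | ‖w.2 j‖ * ‖w.2 j - x‖ ≤ t}.indicator
        (1 : ℝ → ℝ) (p.tau2 T g.1 g.2)) =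
        {g : ℝ × ℝ | ‖w.2 j‖ * ‖w.2 j - x‖ ≤ p.tau2 T g.1 g.2}.indicator 1 := fun j => rfl
    rw [integral_finsetSum]
    · refine Finset.sum_congr rfl fun j hj => ?_
      have hd := hpos j (Finset.mem_range.1 hj)
      rw [integral_const_mul, hI, integral_indicator_one (hmt j),
        ← gainMeasure_lt_sinrReflected p hT hd]
      have hind := iIndepFun_indepFun_comp_of_disjoint (iIndepFun_eval_mark p)
        (fun m => measurable_pi_apply m) (fun k : ℕ => Mark.risBlock i k)
        (fun b : Bool => if b then Mark.bsGain j else Mark.userGain i j)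
        (by intro k b; cases b <;> simp)
      -- Association reads only the blockage variables of user `i`, so filling in zeros for all
      -- other variables does not change the event.
      have hmul := hind.measure_inter_preimage_eq_mul
        {b : ℕ → ℝ | Associated p coordNetwork i x
          (w, reflectedMarks (Sum.elim b (fun _ => 0))) j}
        {b : Bool → ℝ | T < (10 : ℝ) ^ (2 * p.alpha) * p.P0 * b true * b false /
          ((‖w.2 j‖ * ‖w.2 j - x‖) ^ p.beta * p.sigma ^ 2)} ?_ ?_
      · have hlaw := (hasLaw_gains p i j).measureReal_eq
          (p := fun g => T < (10 : ℝ) ^ (2 * p.alpha) * p.P0 * g.1 * g.2 /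
            ((‖w.2 j‖ * ‖w.2 j - x‖) ^ p.beta * p.sigma ^ 2))
          (measurableSet_lt measurable_const (by fun_prop))
        rw [← hlaw]
        have := congrArg ENNReal.toReal hmul
        rw [ENNReal.toReal_mul] at this
        exact this
      · have he : Measurable fun b : ℕ → ℝ => (Sum.elim b (fun _ => 0) : ℕ ⊕ ℕ ⊕ ℕ → ℝ) := by
          refine measurable_pi_iff.2 fun k => ?_
          rcases k with k | k <;> simp only [Sum.elim_inl, Sum.elim_inr] <;> fun_prop
        exact (measurable_reflectedMarks.comp he) (hmA j)
      · exact measurableSet_lt measurable_const (by fun_prop)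
    · intro j _
      refine Integrable.const_mul ?_ _
      rw [hI]
      exact (integrable_const (1 : ℝ)).indicator (hmt j)
  · exact fun j => (hmA j).inter (hmB j)
  · intro j k hjk
    rw [Set.disjoint_left]
    exact fun v hj hk => hjk (hj.1.unique hk.1)
  · rintro j ⟨v, hv⟩
    exact hv.1.1.1

/-- Split by the state of the direct link; its blockage variable is independent of the direct gain
and of all variables of the reflected links. -/
lemma markMeasure_covered {T : ℝ} (hT : 0 < T) (hx : x ≠ 0) (w : ℕ × (ℕ → ℂ))
    (hpos : ∀ j < w.1, 0 < ‖w.2 j‖ * ‖w.2 j - x‖) :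
    p.markMeasure.real {v | Covered p coordNetwork i x T (w, v)} =
      p.pLoS ‖x‖ * Real.exp (-(p.tau1 T ‖x‖ / ((p.NBS : ℝ) * p.Nu))) +
      (1 - p.pLoS ‖x‖) *
        ∫ g, p.assistProb x (cassini x (p.tau2 T g.1 g.2)) w ∂p.gainMeasure := by
  rw [← markMeasure_reflected p i x hT w hpos]
  have hx' : 0 < ‖x‖ := norm_pos_iff.2 hx
  set D : Set (Mark → ℝ) := {v | v (.directBlock i) ≤ p.pLoS ‖x‖}
  set G : Set (Mark → ℝ) := {v | p.tau1 T ‖x‖ < v (.directGain i)}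
  set A : Set (Mark → ℝ) := {v | ∃ j, Associated p coordNetwork i x (w, v) j ∧
        T < sinrReflected p coordNetwork i x (w, v) j}
  have hmD : MeasurableSet D := measurableSet_le (measurable_pi_apply _) measurable_const
  have hmA' : MeasurableSet {y : ℂ × (ℕ × (ℕ → ℂ)) × (Mark → ℝ) |
      ∃ j, Associated p coordNetwork i y.1 y.2 j ∧
        T < sinrReflected p coordNetwork i y.1 y.2 j} := by
    have : {y : ℂ × (ℕ × (ℕ → ℂ)) × (Mark → ℝ) | ∃ j, Associated p coordNetwork i y.1 y.2 j ∧
        T < sinrReflected p coordNetwork i y.1 y.2 j} =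
        ⋃ j, {y | Associated p coordNetwork i y.1 y.2 j ∧
          T < sinrReflected p coordNetwork i y.1 y.2 j} := by ext; simp
    rw [this]
    exact MeasurableSet.iUnion fun j => (measurableSet_associated p i j).inter
      (measurableSet_lt measurable_const (measurable_sinrReflected p i j))
  have hmA : MeasurableSet A := measurableSet_section x hmA' w
  have hset : {v | Covered p coordNetwork i x T (w, v)} = (D ∩ G) ∪ (Dᶜ ∩ A) := by
    ext v
    by_cases hv : v ∈ D
    · have h1 := covered_iff_of_directLoS (S := coordNetwork) (ω := (w, v)) (T := T) (p := p)
        (i := i) (x := x) hv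
      have h2 := lt_sinrDirect_iff p (T := T) (h := v (.directGain i)) hx'
      simp only [mem_union, mem_inter_iff, hv, mem_compl_iff, not_true, true_and, false_and,
        or_false]
      exact h1.trans h2
    · have h1 := covered_iff_of_not_directLoS (S := coordNetwork) (ω := (w, v)) (p := p)
        (i := i) (x := x) hT hv
      simp only [mem_union, mem_inter_iff, hv, mem_compl_iff, not_false_eq_true, true_and,
        false_and, false_or]
      exact h1
  have hDval : p.markMeasure.real D = p.pLoS ‖x‖ :=
    ((hasLaw_eval_mark p (.directBlock i)).measureReal_eq (p := fun z => z ≤ p.pLoS ‖x‖)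
      measurableSet_Iic).trans (uniform_real_Iic (pLoS_mem p (norm_nonneg x)))
  have hGval : p.markMeasure.real G =
      Real.exp (-(p.tau1 T ‖x‖ / ((p.NBS : ℝ) * p.Nu))) := by
    have h1 := (hasLaw_eval_mark p (.directGain i)).measureReal_eq
      (p := fun z => p.tau1 T ‖x‖ < z) measurableSet_Ioi
    have ht : 0 ≤ p.tau1 T ‖x‖ := by
      have := p.P0_pos
      unfold Params.tau1; positivity
    have h2 := expMeasure_real_Ioi (rate_pos p.NBS_pos p.Nu_pos) ht
    rw [one_div_mul_eq_div] at h2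
    exact h1.trans h2
  have hDG : p.markMeasure.real (D ∩ G) = p.markMeasure.real D * p.markMeasure.real G := by
    have hi := (iIndepFun_eval_mark p).indepFun (i := .directBlock i) (j := .directGain i)
      (by simp)
    have := hi.measure_inter_preimage_eq_mul (Iic (p.pLoS ‖x‖)) (Ioi (p.tau1 T ‖x‖))
      measurableSet_Iic measurableSet_Ioi
    have := congrArg ENNReal.toReal this
    rw [ENNReal.toReal_mul] at this
    exact this
  have hDA : p.markMeasure.real (Dᶜ ∩ A) = p.markMeasure.real Dᶜ * p.markMeasure.real A := by
    have hi := iIndepFun_indepFun_comp_of_disjoint (iIndepFun_eval_mark p)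
      (fun m => measurable_pi_apply m) (fun _ : Unit => Mark.directBlock i)
      (reflectedLabel i) (by rintro _ (k | k | k) <;> simp [reflectedLabel])
    have hmul := hi.measure_inter_preimage_eq_mul {u | ¬ u () ≤ p.pLoS ‖x‖}
      (reflectedMarks ⁻¹' A)
      (measurableSet_le (measurable_pi_apply _) measurable_const).compl
      (measurable_reflectedMarks hmA)
    have := congrArg ENNReal.toReal hmul
    rw [ENNReal.toReal_mul] at this
    exact this
  rw [hset, measureReal_union ?_ (hmD.compl.inter hmA), hDG, hDA, probReal_compl_eq_one_sub hmD,
    hDval, hGval]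
  exact (disjoint_compl_right (a := D)).mono inter_subset_left inter_subset_left

end Conditional

/-! ### Polar coordinates in the plane. -/

section Polar

/-- Rotating by `arg x` places the user on the positive real axis; this is why everything depends on
`‖x‖` only. -/
lemma integral_comp_norm_norm_sub (G : ℝ → ℝ → ℝ) (x : ℂ) :
    ∫ y : ℂ, G ‖y‖ ‖y - x‖ = ∫ z : ℂ, G ‖z‖ ‖z - (‖x‖ : ℂ)‖ := by
  let u : Circle := Circle.exp x.arg
  have hu : x = u * ‖x‖ := by
    rw [mul_comm, Circle.coe_exp]
    exact (Complex.norm_mul_exp_arg_mul_I x).symm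
  have h := (rotation u).measurePreserving.integral_comp
    (rotation u).toHomeomorph.measurableEmbedding (fun y : ℂ => G ‖y‖ ‖y - x‖)
  rw [← h]
  refine integral_congr_ae (Filter.Eventually.of_forall fun z => ?_)
  have h1 : ‖rotation u z‖ = ‖z‖ := (rotation u).norm_map z
  have h2 : ‖rotation u z - x‖ = ‖z - (‖x‖ : ℂ)‖ := by
    conv_lhs => rw [hu]
    rw [rotation_apply, ← mul_sub, norm_mul, Circle.norm_coe, one_mul]
  simp only [h1, h2]

variable {F : ℂ → ℝ} {C M : ℝ}

/-- Justifies Fubini in either order of radius and angle. -/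
lemma integrableOn_polar (hF : Measurable F) (hC : ∀ z, |F z| ≤ C) (hM : ∀ z, M < ‖z‖ → F z = 0) :
    IntegrableOn (fun q : ℝ × ℝ => q.1 * F (Complex.polarCoord.symm q))
      (Ioi (0 : ℝ) ×ˢ Ioo (-Real.pi) Real.pi) (volume.prod volume) := by
  have hC0 : 0 ≤ C := (abs_nonneg _).trans (hC 0)
  have hm : Measurable (fun q : ℝ × ℝ => q.1 * F (Complex.polarCoord.symm q)) := by
    simp only [Complex.polarCoord_symm_apply]
    exact measurable_fst.mul (hF.comp (by fun_prop))
  have h1 : IntegrableOn (fun q : ℝ × ℝ => q.1 * F (Complex.polarCoord.symm q))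
      (Ioc (0 : ℝ) M ×ˢ Ioo (-Real.pi) Real.pi) (volume.prod volume) := by
    refine Measure.integrableOn_of_bounded (M := |M| * C) ?_ hm.aestronglyMeasurable ?_
    · rw [Measure.prod_prod]
      exact ENNReal.mul_ne_top (by simp) (by simp)
    · refine (ae_restrict_iff' (measurableSet_Ioc.prod measurableSet_Ioo)).2
        (Filter.Eventually.of_forall fun q hq => ?_)
      rw [Real.norm_eq_abs, abs_mul]
      refine mul_le_mul ?_ (hC _) (abs_nonneg _) (abs_nonneg _)
      rw [abs_of_pos hq.1.1]
      exact hq.1.2.trans (le_abs_self M)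
  refine h1.of_forall_sdiff_eq_zero (measurableSet_Ioi.prod measurableSet_Ioo) fun q hq => ?_
  have hq1 : 0 < q.1 := hq.1.1
  have : M < q.1 := by
    by_contra h
    exact hq.2 ⟨⟨hq1, not_lt.1 h⟩, hq.1.2⟩
  rw [hM _ (by rwa [Complex.norm_polarCoord_symm, abs_of_pos hq1]), mul_zero]

lemma intervalIntegral_neg_pi_pi {g : ℝ → ℝ} (hg : Function.Periodic g (2 * Real.pi)) :
    ∫ θ in Ioo (-Real.pi) Real.pi, g θ = ∫ θ in (0 : ℝ)..(2 * Real.pi), g θ := by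
  rw [← integral_Ioc_eq_integral_Ioo,
    ← intervalIntegral.integral_of_le (by linarith [Real.pi_pos])]
  have := hg.intervalIntegral_add_eq (-Real.pi) 0
  rwa [show -Real.pi + 2 * Real.pi = Real.pi by ring, zero_add] at this

lemma integral_eq_integral_radius_angle (hF : Measurable F) (hC : ∀ z, |F z| ≤ C)
    (hM : ∀ z, M < ‖z‖ → F z = 0) :
    ∫ z, F z = ∫ r in Ioi (0 : ℝ), ∫ θ in (0 : ℝ)..(2 * Real.pi),
      r * F (Complex.polarCoord.symm (r, θ)) := by
  rw [← Complex.integral_comp_polarCoord_symm]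
  refine (setIntegral_prod _ (integrableOn_polar hF hC hM)).trans ?_
  refine setIntegral_congr_fun measurableSet_Ioi fun r _ => ?_
  refine intervalIntegral_neg_pi_pi (g := fun θ => r * F (Complex.polarCoord.symm (r, θ)))
    fun θ => ?_
  simp only [Complex.polarCoord_symm_apply, Real.cos_add_two_pi, Real.sin_add_two_pi]

lemma integral_eq_integral_angle_radius (hF : Measurable F) (hC : ∀ z, |F z| ≤ C)
    (hM : ∀ z, M < ‖z‖ → F z = 0) :
    ∫ z, F z = ∫ θ in (0 : ℝ)..(2 * Real.pi), ∫ r in Ioi (0 : ℝ),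
      r * F (Complex.polarCoord.symm (r, θ)) := by
  rw [← Complex.integral_comp_polarCoord_symm, ← intervalIntegral_neg_pi_pi]
  · have h := integrableOn_polar hF hC hM
    rw [IntegrableOn, ← Measure.prod_restrict] at h
    have h2 := integral_prod_symm _ h
    rw [Measure.prod_restrict] at h2
    exact h2
  · intro θ
    simp only [Complex.polarCoord_symm_apply, Real.cos_add_two_pi, Real.sin_add_two_pi]

lemma norm_polarCoord_symm_sub (r θ ξ : ℝ) :
    ‖Complex.polarCoord.symm (r, θ) - (ξ : ℂ)‖ = Params.thirdSide r ξ θ := by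
  rw [Complex.norm_eq_sqrt_sq_add_sq, Params.thirdSide]
  congr 1
  simp only [Complex.polarCoord_symm_apply, Complex.sub_re, Complex.sub_im, Complex.mul_re,
    Complex.mul_im, Complex.add_re, Complex.add_im, Complex.ofReal_re, Complex.ofReal_im,
    Complex.I_re, Complex.I_im]
  linear_combination r ^ 2 * Real.sin_sq_add_cos_sq θ

lemma norm_polarCoord_symm_add (r θ ξ : ℝ) :
    ‖Complex.polarCoord.symm (r, θ) + (ξ : ℂ)‖ =
      Real.sqrt (r ^ 2 + ξ ^ 2 + 2 * r * ξ * Real.cos θ) := by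
  have h := norm_polarCoord_symm_sub r θ (-ξ)
  rw [Complex.ofReal_neg, sub_neg_eq_add] at h
  rw [h, Params.thirdSide]
  congr 1
  ring

end Polar

/-! ### Integrals against the intensities of surfaces and users. -/

section Intensity

variable (p : Params)

lemma boundaryDist_nonneg {ξ : ℝ} (hξ : 0 ≤ ξ) (hR : ξ ≤ p.R) (θ : ℝ) :
    0 ≤ p.boundaryDist ξ θ := by
  unfold Params.boundaryDist
  rw [sub_nonneg]
  refine Real.le_sqrt_of_sq_le ?_
  have : ξ ^ 2 ≤ p.R ^ 2 := pow_le_pow_left₀ hξ hR 2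
  nlinarith [Real.sin_sq_add_cos_sq θ]

/-- Squared, the left side reads `(r + ξ cos θ)² ≤ R² - ξ² sin² θ`, whose larger root in `r` is
`boundaryDist`. -/
lemma norm_polarCoord_symm_add_le_iff {ξ r : ℝ} (hξ : 0 ≤ ξ) (hR : ξ ≤ p.R) (hr : 0 < r) (θ : ℝ) :
    ‖Complex.polarCoord.symm (r, θ) + (ξ : ℂ)‖ ≤ p.R ↔ r ≤ p.boundaryDist ξ θ := by
  have hsq : ξ ^ 2 ≤ p.R ^ 2 := pow_le_pow_left₀ hξ hR 2
  have hsc := Real.sin_sq_add_cos_sq θ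
  have hnn : 0 ≤ p.R ^ 2 - ξ ^ 2 * Real.sin θ ^ 2 := by nlinarith [sq_nonneg (ξ * Real.cos θ)]
  rw [norm_polarCoord_symm_add, Real.sqrt_le_left p.R_pos.le, Params.boundaryDist, le_sub_iff_add_le]
  constructor
  · intro h
    refine Real.le_sqrt_of_sq_le ?_
    nlinarith
  · intro h
    -- The opposite direction gives `-√(R² - ξ² sin² θ) ≤ ξ cos θ`, the lower bound needed for
    -- squaring.
    have hb := boundaryDist_nonneg p hξ hR (θ + Real.pi)
    rw [Params.boundaryDist, Real.sin_add_pi, Real.cos_add_pi, neg_sq] at hb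
    have h2 := abs_le_of_sq_le_sq' (a := r + ξ * Real.cos θ)
      (b := Real.sqrt (p.R ^ 2 - ξ ^ 2 * Real.sin θ ^ 2)) ?_ (Real.sqrt_nonneg _)
    · have h3 : (r + ξ * Real.cos θ) ^ 2 ≤ p.R ^ 2 - ξ ^ 2 * Real.sin θ ^ 2 := by
        rw [← Real.sq_sqrt hnn]
        exact sq_le_sq' h2.1 h2.2
      nlinarith
    · exact sq_le_sq' (by linarith) h

lemma integral_risIntensity (f : ℂ → ℝ) :
    ∫ y, f y ∂p.risIntensity = ∫ y in Metric.closedBall (0 : ℂ) p.R, p.lamR * f y := by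
  unfold Params.risIntensity
  rw [integral_smul_measure, ENNReal.toReal_ofReal p.lamR_pos.le, smul_eq_mul,
    integral_const_mul]

lemma abs_ite_pLoS_le (q : Prop) [Decidable q] {d : ℝ} (hd : 0 ≤ d) :
    |if q then p.lamR * p.pLoS d else 0| ≤ p.lamR := by
  have h := pLoS_mem p hd
  have := p.lamR_pos
  split_ifs
  · rw [abs_of_nonneg (mul_nonneg this.le h.1)]
    exact mul_le_of_le_one_right this.le h.2
  · simpa using this.le

/-- Polar coordinates centred at the user: after the translation by `ξ`, the cell is described by
`boundaryDist` on each ray. -/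
lemma integral_pLoS_risIntensity {x : ℂ} (hxR : ‖x‖ ≤ p.R) :
    ∫ y, p.pLoS ‖y - x‖ ∂p.risIntensity = p.meanAssisting ‖x‖ := by
  classical
  have hξ := norm_nonneg x
  set ξ := ‖x‖ with hξdef
  rw [integral_risIntensity, ← integral_indicator Metric.isClosed_closedBall.measurableSet]
  have h1 : ∀ y : ℂ, (Metric.closedBall (0 : ℂ) p.R).indicator
      (fun y => p.lamR * p.pLoS ‖y - x‖) y =
      (fun a b : ℝ => if a ≤ p.R then p.lamR * p.pLoS b else 0) ‖y‖ ‖y - x‖ := fun y => by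
    simp [indicator_apply]
  simp only [h1]
  rw [integral_comp_norm_norm_sub (fun a b : ℝ => if a ≤ p.R then p.lamR * p.pLoS b else 0) x,
    ← integral_add_right_eq_self _ (ξ : ℂ)]
  simp only [← hξdef, add_sub_cancel_right]
  rw [integral_eq_integral_angle_radius (C := p.lamR) (M := 2 * p.R)]
  · unfold Params.meanAssisting
    refine intervalIntegral.integral_congr fun θ _ => ?_
    rw [intervalIntegral.integral_of_le (boundaryDist_nonneg p hξ hxR θ),
      ← integral_indicator measurableSet_Ioi, ← integral_indicator measurableSet_Ioc]
    refine integral_congr_ae (Filter.Eventually.of_forall fun r => ?_)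
    by_cases hr : 0 < r
    · have hiff := norm_polarCoord_symm_add_le_iff p hξ hxR hr θ
      by_cases hb : r ≤ p.boundaryDist ξ θ
      · simp only [indicator_apply, mem_Ioi, hr, mem_Ioc, hb, hiff, and_self, if_true,
          Complex.norm_polarCoord_symm, abs_of_pos hr]
        ring
      · simp only [indicator_apply, mem_Ioi, hr, mem_Ioc, hb, hiff, and_false, if_true, if_false,
          mul_zero]
    · simp [hr]
  · refine Measurable.ite (measurableSet_le (by fun_prop) measurable_const) ?_ measurable_const
    exact measurable_const.mul ((measurable_pLoS p).comp measurable_norm)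
  · exact fun z => abs_ite_pLoS_le p _ (norm_nonneg _)
  · intro z hz
    refine if_neg fun h => ?_
    have h2 := norm_sub_le (z + (ξ : ℂ)) (ξ : ℂ)
    rw [add_sub_cancel_right, Complex.norm_real, Real.norm_eq_abs, abs_of_nonneg hξ] at h2
    linarith

/-- Polar coordinates centred at the base station; the distance to the user is `thirdSide` by the
law of cosines. -/
lemma integral_cassini_risIntensity (x : ℂ) (t : ℝ) :
    ∫ y, (cassini x t).indicator (fun y => p.pLoS ‖y - x‖) y ∂p.risIntensity =
      p.meanAssistingLE ‖x‖ t := by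
  classical
  set ξ := ‖x‖ with hξdef
  rw [integral_risIntensity, ← integral_indicator Metric.isClosed_closedBall.measurableSet]
  have h1 : ∀ y : ℂ, (Metric.closedBall (0 : ℂ) p.R).indicator
      (fun y => p.lamR * (cassini x t).indicator (fun y => p.pLoS ‖y - x‖) y) y =
      (fun a b : ℝ => if a ≤ p.R ∧ a * b ≤ t then p.lamR * p.pLoS b else 0) ‖y‖ ‖y - x‖ :=
      fun y => by
    by_cases ha : ‖y‖ ≤ p.R <;> by_cases hb : ‖y‖ * ‖y - x‖ ≤ t <;>
      simp [indicator_apply, cassini, ha, hb]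
  simp only [h1]
  rw [integral_comp_norm_norm_sub
    (fun a b : ℝ => if a ≤ p.R ∧ a * b ≤ t then p.lamR * p.pLoS b else 0) x]
  simp only [← hξdef]
  rw [integral_eq_integral_radius_angle (C := p.lamR) (M := p.R)]
  · unfold Params.meanAssistingLE
    rw [intervalIntegral.integral_of_le p.R_pos.le, ← integral_indicator measurableSet_Ioi,
      ← integral_indicator measurableSet_Ioc]
    refine integral_congr_ae (Filter.Eventually.of_forall fun r => ?_)
    by_cases hr : 0 < r
    · by_cases hb : r ≤ p.R
      · simp only [indicator_apply, mem_Ioi, hr, mem_Ioc, hb, and_self, if_true]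
        refine intervalIntegral.integral_congr fun θ _ => ?_
        simp only [norm_polarCoord_symm_sub, Complex.norm_polarCoord_symm, abs_of_pos hr, hb,
          true_and, mul_ite, mul_zero]
        split_ifs
        · ring
        · rfl
      · simp [hr, hb, abs_of_pos hr]
    · simp [hr]
  · have hd : Measurable fun z : ℂ => ‖z - (ξ : ℂ)‖ := by fun_prop
    refine Measurable.ite ((measurableSet_le measurable_norm measurable_const).inter
      (measurableSet_le (measurable_norm.mul hd) measurable_const)) ?_ measurable_const
    exact measurable_const.mul ((measurable_pLoS p).comp hd)
  · exact fun z => abs_ite_pLoS_le p _ (norm_nonneg _)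
  · exact fun z hz => if_neg fun h => hz.not_ge h.1

lemma integral_userIntensity {c : ℂ → ℝ} {g : ℝ → ℝ}
    (hc : ∀ x : ℂ, 0 < ‖x‖ → ‖x‖ ≤ p.R → c x = g ‖x‖) :
    ∫ x, c x ∂p.userIntensity =
      ∫ ξ in (0 : ℝ)..p.R, g ξ * p.lamU ξ * (2 * Real.pi * ξ) := by
  unfold Params.userIntensity
  have hm : Measurable fun x : ℂ => ENNReal.ofReal (p.lamU ‖x‖) :=
    (p.lamU_meas.comp measurable_norm).ennreal_ofReal
  rw [integral_withDensity_eq_integral_toReal_smul hm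
    (Filter.Eventually.of_forall fun _ => ENNReal.ofReal_lt_top),
    ← integral_indicator Metric.isClosed_closedBall.measurableSet]
  have h0 : ∀ᵐ x : ℂ, x ≠ 0 := by simp [ae_iff]
  have h1 : (∫ x : ℂ, (Metric.closedBall (0 : ℂ) p.R).indicator
      (fun x => (ENNReal.ofReal (p.lamU ‖x‖)).toReal • c x) x) =
      ∫ x : ℂ, (Iic p.R).indicator (fun ξ => p.lamU ξ * g ξ) ‖x‖ := by
    refine integral_congr_ae ?_
    filter_upwards [h0] with x hx
    by_cases hR : ‖x‖ ≤ p.R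
    · simp [hR, hc x (norm_pos_iff.2 hx) hR,
        p.lamU_nonneg _ ⟨norm_nonneg x, hR⟩]
    · simp [hR]
  rw [h1, integral_fun_norm_addHaar, Complex.finrank_real_complex, measureReal_def,
    Complex.volume_ball, intervalIntegral.integral_of_le p.R_pos.le,
    ← integral_indicator measurableSet_Ioi, ← integral_indicator measurableSet_Ioc]
  simp only [ENNReal.ofReal_one, one_pow, one_mul, ENNReal.coe_toReal, NNReal.coe_real_pi]
  rw [← integral_smul, nsmul_eq_mul, ← integral_const_mul]
  refine integral_congr_ae (Filter.Eventually.of_forall fun r => ?_)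
  by_cases hr : 0 < r <;> by_cases hb : r ≤ p.R <;> simp [indicator_apply, hr, hb]
  ring

end Intensity

/-! ### Freezing one of two independent variables. -/

section Decoupling

variable {Ω α β : Type*} [MeasurableSpace Ω] [MeasurableSpace α] [MeasurableSpace β]
  {P : Measure Ω} [IsProbabilityMeasure P] {U : Ω → α} {V : Ω → β}

lemma measure_mem_of_indepFun (h : IndepFun U V P) (hU : Measurable U) (hV : Measurable V)
    {A : Set (α × β)} (hA : MeasurableSet A) :
    P {ω | (U ω, V ω) ∈ A} = ∫⁻ ω, (P.map V) {b | (U ω, b) ∈ A} ∂P := by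
  have h1 : P {ω | (U ω, V ω) ∈ A} = P.map (fun ω => (U ω, V ω)) A :=
    (Measure.map_apply (hU.prodMk hV) hA).symm
  have := Measure.isProbabilityMeasure_map (μ := P) hV.aemeasurable
  rw [h1, h.map_prod_eq_prod_map_map hU.aemeasurable hV.aemeasurable, Measure.prod_apply hA,
    lintegral_map (measurable_measure_prodMk_left hA) hU]
  rfl

lemma measureReal_mem_of_indepFun (h : IndepFun U V P) (hU : Measurable U) (hV : Measurable V)
    {A : Set (α × β)} (hA : MeasurableSet A) :
    P.real {ω | (U ω, V ω) ∈ A} = ∫ ω, (P.map V).real {b | (U ω, b) ∈ A} ∂P := by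
  have := Measure.isProbabilityMeasure_map (μ := P) hV.aemeasurable
  rw [measureReal_def, measure_mem_of_indepFun h hU hV hA, ← integral_toReal]
  · rfl
  · exact ((measurable_measure_prodMk_left hA).comp hU).aemeasurable
  · exact Filter.Eventually.of_forall fun ω => measure_lt_top _ _

/-- The joint law is `(μ_U × μ_V) × μ_W`; reassociate the product. -/
lemma indepFun_prodMk_of_indepFun {γ : Type*} [MeasurableSpace γ] {W : Ω → γ}
    (hU : Measurable U) (hV : Measurable V) (hW : Measurable W) (h : IndepFun U V P)
    (h' : IndepFun (fun ω => (U ω, V ω)) W P) : IndepFun U (fun ω => (V ω, W ω)) P := by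
  have := Measure.isProbabilityMeasure_map (μ := P) hU.aemeasurable
  have := Measure.isProbabilityMeasure_map (μ := P) hV.aemeasurable
  have := Measure.isProbabilityMeasure_map (μ := P) hW.aemeasurable
  have hVW : IndepFun V W P := h'.comp measurable_snd measurable_id
  rw [indepFun_iff_map_prod_eq_prod_map_map hU.aemeasurable (hV.prodMk hW).aemeasurable,
    hVW.map_prod_eq_prod_map_map hV.aemeasurable hW.aemeasurable, ← Measure.prodAssoc_prod,
    ← h.map_prod_eq_prod_map_map hU.aemeasurable hV.aemeasurable,
    ← h'.map_prod_eq_prod_map_map (hU.prodMk hV).aemeasurable hW.aemeasurable,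
    Measure.map_map MeasurableEquiv.prodAssoc.measurable ((hU.prodMk hV).prodMk hW)]
  rfl

end Decoupling

/-! ### Averaging over the surfaces: closed forms for a user at a fixed place. -/

section Model

lemma measurableSet_exists_assists {Q : Set ℂ} (hQ : MeasurableSet Q) (p : Params) (i : ℕ) (x : ℂ) :
    MeasurableSet {q : (ℕ × (ℕ → ℂ)) × (Mark → ℝ) |
      ∃ j, Assists p coordNetwork i x q j ∧ q.1.2 j ∈ Q} := by
  have : {q : (ℕ × (ℕ → ℂ)) × (Mark → ℝ) | ∃ j, Assists p coordNetwork i x q j ∧ q.1.2 j ∈ Q} =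
      ⋃ j, {q | Assists p coordNetwork i x q j ∧ q.1.2 j ∈ Q} := by ext; simp
  rw [this]
  refine MeasurableSet.iUnion fun j => MeasurableSet.inter ?_ ?_
  · exact (measurable_const.prodMk measurable_id) (measurableSet_assists p i j)
  · exact ((measurable_pi_apply j).comp (measurable_snd.comp measurable_fst)) hQ

lemma measurable_indicator_pLoS (p : Params) (x : ℂ) {Q : Set ℂ} (hQ : MeasurableSet Q) :
    Measurable (Q.indicator fun y => p.pLoS ‖y - x‖) :=
  ((measurable_pLoS p).comp (by fun_prop)).indicator hQ

lemma indicator_pLoS_mem (p : Params) (x : ℂ) (Q : Set ℂ) (y : ℂ) :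
    Q.indicator (fun y => p.pLoS ‖y - x‖) y ∈ Icc (0 : ℝ) 1 := by
  by_cases h : y ∈ Q
  · rw [indicator_of_mem h]; exact pLoS_mem p (norm_nonneg _)
  · rw [indicator_of_notMem h]; simp

lemma assistProb_mem (p : Params) (x : ℂ) (Q : Set ℂ) (w : ℕ × (ℕ → ℂ)) :
    p.assistProb x Q w ∈ Icc (0 : ℝ) 1 := by
  have h0 : ∀ j, 0 ≤ 1 - Q.indicator (fun y => p.pLoS ‖y - x‖) (w.2 j) := fun j =>
    sub_nonneg.2 (indicator_pLoS_mem p x Q _).2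
  have h1 : ∀ j, 1 - Q.indicator (fun y => p.pLoS ‖y - x‖) (w.2 j) ≤ 1 := fun j =>
    sub_le_self _ (indicator_pLoS_mem p x Q _).1
  unfold Params.assistProb
  have h2 := Finset.prod_nonneg (s := Finset.range w.1) fun j _ => h0 j
  have h3 := Finset.prod_le_one (s := Finset.range w.1) (fun j _ => h0 j) fun j _ => h1 j
  exact ⟨by linarith, by linarith⟩

variable {Ω : Type*} [MeasurableSpace Ω] {P : Measure Ω} {p : Params}
  {S : Network Ω} (i : ℕ) (x : ℂ)

lemma IsModel.measurable_users (hS : IsModel p P S) : Measurable fun ω => (S.numUsers ω, fun i => S.userPos i ω) :=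
  hS.users.measurable_num.prodMk (measurable_pi_iff.2 hS.users.measurable_pos)

lemma IsModel.measurable_riss (hS : IsModel p P S) : Measurable fun ω => (S.numRIS ω, fun j => S.risPos j ω) :=
  hS.riss.measurable_num.prodMk (measurable_pi_iff.2 hS.riss.measurable_pos)

lemma IsModel.measurable_marks (hS : IsModel p P S) : Measurable fun ω m => S.mark m ω :=
  measurable_pi_iff.2 hS.measurable_mark

lemma IsModel.measurable_config (hS : IsModel p P S) : Measurable S.config :=
  hS.measurable_riss.prodMk hS.measurable_marks

lemma IsModel.map_marks (hS : IsModel p P S) : P.map (fun ω m => S.mark m ω) = p.markMeasure := by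
  rw [hS.indep_marks.map_fun_eq_infinitePi_map hS.measurable_mark, Params.markMeasure]
  congr 1
  ext1 m
  exact (hS.law_mark m).map_eq

lemma IsModel.indepFun_riss_marks (hS : IsModel p P S) :
    IndepFun (fun ω => (S.numRIS ω, fun j => S.risPos j ω)) (fun ω m => S.mark m ω) P :=
  hS.indep_points_marks.comp measurable_snd measurable_id

lemma IsModel.indepFun_users_config [IsProbabilityMeasure P] (hS : IsModel p P S) :
    IndepFun (fun ω => (S.numUsers ω, fun i => S.userPos i ω)) S.config P :=
  indepFun_prodMk_of_indepFun hS.measurable_users hS.measurable_riss hS.measurable_marks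
    hS.indep_users_riss hS.indep_points_marks

lemma IsModel.measureReal_config_mem [IsProbabilityMeasure P] (hS : IsModel p P S) {A : Set ((ℕ × (ℕ → ℂ)) × (Mark → ℝ))}
    (hA : MeasurableSet A) :
    P.real {ω | S.config ω ∈ A} =
      ∫ ω, p.markMeasure.real {v | ((S.numRIS ω, fun j => S.risPos j ω), v) ∈ A} ∂P := by
  rw [← hS.map_marks]
  exact measureReal_mem_of_indepFun hS.indepFun_riss_marks hS.measurable_riss
    hS.measurable_marks hA

lemma IsModel.integral_assistProb [IsProbabilityMeasure P] (hS : IsModel p P S) {Q : Set ℂ} (hQ : MeasurableSet Q) :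
    ∫ ω, p.assistProb x Q (S.numRIS ω, fun j => S.risPos j ω) ∂P =
      1 - Real.exp (-∫ y, Q.indicator (fun y => p.pLoS ‖y - x‖) y ∂p.risIntensity) := by
  have hm := measurable_indicator_pLoS p x hQ
  have hI := indicator_pLoS_mem p x Q
  have h := hS.riss.integral_prod (f := fun y => 1 - Q.indicator (fun y => p.pLoS ‖y - x‖) y)
    (measurable_const.sub hm) fun y => ⟨sub_nonneg.2 (hI y).2, sub_le_self _ (hI y).1⟩
  simp only [sub_sub_cancel] at h
  rw [← h]
  unfold Params.assistProb
  rw [integral_sub (integrable_const _)]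
  · simp
  · refine Integrable.of_bound (C := 1) (measurable_prod_range hS.riss.measurable_num fun j =>
      (measurable_const.sub hm).comp (hS.riss.measurable_pos j)).aestronglyMeasurable
      (Filter.Eventually.of_forall fun ω => ?_)
    rw [Real.norm_eq_abs, abs_of_nonneg
      (Finset.prod_nonneg fun j _ => sub_nonneg.2 (hI _).2)]
    exact Finset.prod_le_one (fun j _ => sub_nonneg.2 (hI _).2) fun j _ => sub_le_self _ (hI _).1

lemma IsModel.measureReal_exists_assists [IsProbabilityMeasure P] (hS : IsModel p P S) {Q : Set ℂ} (hQ : MeasurableSet Q) :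
    P.real {ω | ∃ j, Assists p S i x ω j ∧ S.risPos j ω ∈ Q} =
      1 - Real.exp (-∫ y, Q.indicator (fun y => p.pLoS ‖y - x‖) y ∂p.risIntensity) := by
  rw [← hS.integral_assistProb x hQ]
  refine (hS.measureReal_config_mem (measurableSet_exists_assists hQ p i x)).trans ?_
  exact integral_congr_ae (Filter.Eventually.of_forall fun ω =>
    markMeasure_assists p i x Q (S.numRIS ω, fun j => S.risPos j ω))

lemma IsModel.reflectionProb_eq [IsProbabilityMeasure P] (hS : IsModel p P S) (hxR : ‖x‖ ≤ p.R) :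
    reflectionProb p S i x P = p.PR ‖x‖ := by
  have h := hS.measureReal_exists_assists i x MeasurableSet.univ
  simp only [mem_univ, and_true, indicator_univ] at h
  rw [integral_pLoS_risIntensity p hxR] at h
  exact h

lemma IsModel.measureReal_eta_le [IsProbabilityMeasure P] (hS : IsModel p P S) (t : ℝ) :
    P.real ({ω | HasReflected p S i x ω} ∩ {ω | eta p S i x ω ≤ t}) =
      1 - Real.exp (-p.meanAssistingLE ‖x‖ t) := by
  rw [← integral_cassini_risIntensity, ← hS.measureReal_exists_assists i x
    (measurableSet_cassini x t)]
  congr 1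
  ext ω
  exact hasReflected_and_eta_le_iff

lemma IsModel.measurableSet_hasReflected [IsProbabilityMeasure P] (hS : IsModel p P S) : MeasurableSet {ω | HasReflected p S i x ω} := by
  have h := hS.measurable_config (measurableSet_exists_assists MeasurableSet.univ p i x)
  simp only [mem_univ, and_true] at h
  exact h

lemma IsModel.etaCDF_eq [IsProbabilityMeasure P] (hS : IsModel p P S) (hxR : ‖x‖ ≤ p.R) (t : ℝ) :
    etaCDF p S i x P t = p.Feta ‖x‖ t := by
  rw [etaCDF, measureReal_def, cond_apply (hS.measurableSet_hasReflected i x), ENNReal.toReal_mul,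
    ENNReal.toReal_inv, ← measureReal_def, ← measureReal_def, hS.measureReal_eta_le, Params.Feta,
    ← hS.reflectionProb_eq i x hxR, div_eq_inv_mul]
  rfl

/-- Clears the denominator of `Feta` without proving `PR ≠ 0`: the right side is the probability of
a subevent of `HasReflected`, so it vanishes when `PR` does. -/
lemma IsModel.PR_mul_Feta [IsProbabilityMeasure P] (hS : IsModel p P S) (hxR : ‖x‖ ≤ p.R) (t : ℝ) :
    p.PR ‖x‖ * p.Feta ‖x‖ t = 1 - Real.exp (-p.meanAssistingLE ‖x‖ t) := by
  rcases eq_or_ne (p.PR ‖x‖) 0 with h0 | h0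
  · rw [h0, zero_mul, ← hS.measureReal_eta_le 0 x t]
    refine (le_antisymm ?_ measureReal_nonneg).symm
    refine (measureReal_mono inter_subset_left).trans_eq ?_
    exact (hS.reflectionProb_eq 0 x hxR).trans h0
  · rw [Params.Feta, mul_div_cancel₀ _ h0]

/-- The numerator is a probability increasing in `t`, and monotone functions are measurable. -/
lemma IsModel.measurable_Feta [IsProbabilityMeasure P] (hS : IsModel p P S) : Measurable (p.Feta ‖x‖) := by
  have h : Monotone fun t => 1 - Real.exp (-p.meanAssistingLE ‖x‖ t) := by
    intro s t hst
    simp only [← hS.measureReal_eta_le 0 x]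
    exact measureReal_mono (inter_subset_inter_right _ fun ω hω => le_trans hω hst)
  exact h.measurable.div_const _

lemma IsModel.abs_Feta_le [IsProbabilityMeasure P] (hS : IsModel p P S) (t : ℝ) : |p.Feta ‖x‖ t| ≤ |p.PR ‖x‖|⁻¹ := by
  rw [Params.Feta, abs_div, ← hS.measureReal_eta_le 0 x t, abs_of_nonneg measureReal_nonneg,
    div_eq_mul_inv]
  exact mul_le_of_le_one_left (by positivity) measureReal_le_one

lemma IsModel.ae_distProd_pos (hS : IsModel p P S) :
    ∀ᵐ ω ∂P, ∀ j < S.numRIS ω, 0 < ‖S.risPos j ω‖ * ‖S.risPos j ω - x‖ := by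
  have h0 : p.risIntensity {0, x} = 0 := by
    have h1 : (volume : Measure ℂ) {0, x} = 0 := (Set.toFinite _).measure_zero _
    rw [Params.risIntensity, Measure.smul_apply, Measure.restrict_apply' measurableSet_closedBall,
      measure_mono_null inter_subset_left h1, smul_zero]
  filter_upwards [hS.riss.ae_notMem (Set.toFinite _).measurableSet h0] with ω hω j hj
  have h2 := hω j hj
  simp only [mem_insert_iff, mem_singleton_iff, not_or] at h2
  exact mul_pos (norm_pos_iff.2 h2.1) (norm_pos_iff.2 (sub_ne_zero.2 h2.2))

lemma IsModel.integrable_assistProb [IsProbabilityMeasure P] (hS : IsModel p P S) (T : ℝ) :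
    Integrable (Function.uncurry fun ω (g : ℝ × ℝ) =>
      p.assistProb x (cassini x (p.tau2 T g.1 g.2)) (S.numRIS ω, fun j => S.risPos j ω))
      (P.prod p.gainMeasure) := by
  classical
  have hm : Measurable (Function.uncurry fun ω (g : ℝ × ℝ) =>
      p.assistProb x (cassini x (p.tau2 T g.1 g.2)) (S.numRIS ω, fun j => S.risPos j ω)) := by
    refine measurable_const.sub (measurable_prod_range
      (hS.riss.measurable_num.comp measurable_fst) fun j => measurable_const.sub ?_)
    have hX : Measurable fun a : Ω × ℝ × ℝ => S.risPos j a.1 :=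
      (hS.riss.measurable_pos j).comp measurable_fst
    simp only [indicator_apply]
    refine Measurable.ite ?_ ((measurable_pLoS p).comp (hX.sub_const x).norm) measurable_const
    exact measurableSet_le (hX.norm.mul (hX.sub_const x).norm)
      ((measurable_tau2 p T).comp measurable_snd)
  refine Integrable.of_bound (C := 1) hm.aestronglyMeasurable
    (Filter.Eventually.of_forall fun a => ?_)
  have h := assistProb_mem p x (cassini x (p.tau2 T a.2.1 a.2.2))
    (S.numRIS a.1, fun j => S.risPos j a.1)
  rw [Real.norm_eq_abs, abs_le]
  exact ⟨le_trans (by norm_num) h.1, h.2⟩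

lemma IsModel.integral_gain_assistProb [IsProbabilityMeasure P] (hS : IsModel p P S) (hxR : ‖x‖ ≤ p.R) (T : ℝ) :
    ∫ ω, ∫ g, p.assistProb x (cassini x (p.tau2 T g.1 g.2))
        (S.numRIS ω, fun j => S.risPos j ω) ∂p.gainMeasure ∂P =
      p.PR ‖x‖ * ∫ y in Ioi (0 : ℝ), (∫ z in Ioi (0 : ℝ),
        p.Feta ‖x‖ (p.tau2 T z y) * Params.expDensity ((p.NBS : ℝ) * p.NR) z) *
          Params.expDensity ((p.NR : ℝ) * p.Nu) y := by
  have hp1 := isProbabilityMeasure_expMeasure (rate_pos p.NBS_pos p.NR_pos)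
  have hp2 := isProbabilityMeasure_expMeasure (rate_pos p.NR_pos p.Nu_pos)
  have hN1 : (0 : ℝ) < (p.NBS : ℝ) * p.NR := by
    have := p.NBS_pos; have := p.NR_pos; positivity
  have hN2 : (0 : ℝ) < (p.NR : ℝ) * p.Nu := by
    have := p.NR_pos; have := p.Nu_pos; positivity
  -- With the gains outside, the level `tau2` is fixed while the surfaces are averaged, so the
  -- Laplace functional applies.
  rw [integral_integral_swap]
  · simp only [hS.integral_assistProb x (measurableSet_cassini x _),
      integral_cassini_risIntensity, ← hS.PR_mul_Feta x hxR]
    rw [integral_const_mul]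
    congr 1
    have hint : Integrable (fun g : ℝ × ℝ => p.Feta ‖x‖ (p.tau2 T g.1 g.2)) p.gainMeasure :=
      Integrable.of_bound (C := |p.PR ‖x‖|⁻¹)
        ((hS.measurable_Feta x).comp (measurable_tau2 p T)).aestronglyMeasurable
        (Filter.Eventually.of_forall fun g => hS.abs_Feta_le x _)
    refine (integral_prod_symm _ hint).trans ?_
    simp only [integral_expMeasure hN1]
    rw [integral_expMeasure hN2]
  · exact hS.integrable_assistProb x T

lemma IsModel.coverageProb_eq [IsProbabilityMeasure P] (hS : IsModel p P S) {T : ℝ} (hT : 0 < T) (hx : 0 < ‖x‖) (hxR : ‖x‖ ≤ p.R) :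
    coverageProb p S i x P T = p.Pcov T ‖x‖ := by
  have hA : MeasurableSet {q | Covered p coordNetwork i x T q} :=
    (measurable_const.prodMk measurable_id) (measurableSet_covered p i T)
  rw [Params.Pcov, mul_assoc (1 - _), ← hS.integral_gain_assistProb x hxR T]
  refine (hS.measureReal_config_mem hA).trans ?_
  have hae : (fun ω => p.markMeasure.real
      {v | ((S.numRIS ω, fun j => S.risPos j ω), v) ∈ {q | Covered p coordNetwork i x T q}}) =ᵐ[P]
      fun ω => p.pLoS ‖x‖ * Real.exp (-(p.tau1 T ‖x‖ / ((p.NBS : ℝ) * p.Nu))) +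
        (1 - p.pLoS ‖x‖) * ∫ g, p.assistProb x (cassini x (p.tau2 T g.1 g.2))
          (S.numRIS ω, fun j => S.risPos j ω) ∂p.gainMeasure := by
    filter_upwards [hS.ae_distProd_pos x] with ω hω
    exact markMeasure_covered p i x hT (norm_pos_iff.1 hx) _ hω
  have hint : Integrable (fun ω => ∫ g, p.assistProb x (cassini x (p.tau2 T g.1 g.2))
      (S.numRIS ω, fun j => S.risPos j ω) ∂p.gainMeasure) P :=
    (hS.integrable_assistProb x T).integral_prod_left
  rw [integral_congr_ae hae, integral_add (integrable_const _) (hint.const_mul _),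
    integral_const, probReal_univ, one_smul, integral_const_mul]

end Model

/-! ### Averaging over the users. -/

section Users

lemma numCovered_eq_tsum {Ω : Type*} (p : Params) (S : Network Ω) (T : ℝ) (ω : Ω) :
    (numCovered p S T ω : ℝ≥0∞) =
      ∑' i, {ω | i < S.numUsers ω ∧ Covered p S i (S.userPos i ω) T ω}.indicator 1 ω := by
  classical
  rw [tsum_eq_sum (s := Finset.range (S.numUsers ω))]
  · rw [numCovered, Finset.card_filter]
    push_cast
    refine Finset.sum_congr rfl fun i hi => ?_
    simp [indicator_apply, Finset.mem_range.1 hi]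
  · intro i hi
    exact indicator_of_notMem (fun h => hi (Finset.mem_range.2 h.1)) _

lemma coverageProb_nonneg {Ω : Type*} [MeasurableSpace Ω] (p : Params) (S : Network Ω) (i : ℕ)
    (x : ℂ) (P : Measure Ω) (T : ℝ) : 0 ≤ coverageProb p S i x P T := measureReal_nonneg

variable {Ω : Type*} [MeasurableSpace Ω] {P : Measure Ω} {p : Params} {S : Network Ω}

lemma IsModel.ae_userPos (hS : IsModel p P S) :
    ∀ᵐ ω ∂P, ∀ i < S.numUsers ω, 0 < ‖S.userPos i ω‖ ∧ ‖S.userPos i ω‖ ≤ p.R := by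
  have hm : MeasurableSet {x : ℂ | ¬ (0 < ‖x‖ ∧ ‖x‖ ≤ p.R)} :=
    ((measurableSet_lt measurable_const measurable_norm).inter
      (measurableSet_le measurable_norm measurable_const)).compl
  have h0 : p.userIntensity {x : ℂ | ¬ (0 < ‖x‖ ∧ ‖x‖ ≤ p.R)} = 0 := by
    refine withDensity_absolutelyContinuous _ _ ?_
    rw [Measure.restrict_apply' measurableSet_closedBall]
    refine measure_mono_null (t := {0}) ?_ (by simp)
    rintro x ⟨hx, hx'⟩
    rw [mem_closedBall_zero_iff] at hx'
    by_contra h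
    exact hx ⟨norm_pos_iff.2 h, hx'⟩
  filter_upwards [hS.users.ae_notMem hm h0] with ω hω i hi
  exact not_not.1 (hω i hi)

lemma IsModel.measurable_coverageProb [IsProbabilityMeasure P] (hS : IsModel p P S) (i : ℕ)
    (T : ℝ) : Measurable fun x => coverageProb p S i x P T := by
  have hA : MeasurableSet {y : ℂ × Ω | Covered p coordNetwork i y.1 T (S.config y.2)} :=
    (measurable_fst.prodMk (hS.measurable_config.comp measurable_snd)) (measurableSet_covered p i T)
  exact (measurable_measure_prodMk_left (ν := P) hA).ennreal_toReal

lemma IsModel.measurableSet_user_covered (hS : IsModel p P S) (i : ℕ) (T : ℝ) :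
    MeasurableSet {ω | i < S.numUsers ω ∧ Covered p S i (S.userPos i ω) T ω} :=
  (measurableSet_lt measurable_const hS.users.measurable_num).inter
    (((hS.users.measurable_pos i).prodMk hS.measurable_config) (measurableSet_covered p i T))

/-- The position of user `i` is independent of the surfaces and link variables, so coverage may be
evaluated at a frozen place and then averaged. -/
lemma IsModel.measure_user_covered [IsProbabilityMeasure P] (hS : IsModel p P S) (i : ℕ) (T : ℝ) :
    P {ω | i < S.numUsers ω ∧ Covered p S i (S.userPos i ω) T ω} =
      ∫⁻ ω in {ω | i < S.numUsers ω},
        ENNReal.ofReal (coverageProb p S i (S.userPos i ω) P T) ∂P := by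
  have hA : MeasurableSet {a : (ℕ × (ℕ → ℂ)) × (ℕ × (ℕ → ℂ)) × (Mark → ℝ) |
      i < a.1.1 ∧ Covered p coordNetwork i (a.1.2 i) T a.2} := by
    refine (measurableSet_lt measurable_const (measurable_fst.comp measurable_fst)).inter ?_
    have hX : Measurable fun a : (ℕ × (ℕ → ℂ)) × (ℕ × (ℕ → ℂ)) × (Mark → ℝ) => a.1.2 i :=
      (measurable_pi_apply i).comp (measurable_snd.comp measurable_fst)
    exact (hX.prodMk measurable_snd) (measurableSet_covered p i T)
  refine (measure_mem_of_indepFun hS.indepFun_users_config hS.measurable_users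
    hS.measurable_config hA).trans ?_
  rw [← lintegral_indicator (measurableSet_lt measurable_const hS.users.measurable_num)]
  refine lintegral_congr fun ω => ?_
  have hC : MeasurableSet {q | Covered p coordNetwork i (S.userPos i ω) T q} :=
    (measurable_const.prodMk measurable_id) (measurableSet_covered p i T)
  by_cases hi : i < S.numUsers ω
  · simp only [mem_ofPred_eq, hi, true_and, indicator_of_mem]
    rw [Measure.map_apply hS.measurable_config hC, coverageProb, ofReal_measureReal]
    rfl
  · simp [hi]

lemma integral_natCast_eq_toReal {n : Ω → ℕ} (hn : AEMeasurable (fun ω => (n ω : ℝ≥0∞)) P) :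
    ∫ ω, (n ω : ℝ) ∂P = (∫⁻ ω, (n ω : ℝ≥0∞) ∂P).toReal := by
  rw [← integral_toReal hn (Filter.Eventually.of_forall fun ω => ENNReal.natCast_lt_top _)]
  simp

lemma IsModel.integral_numCovered [IsProbabilityMeasure P] (hS : IsModel p P S) (T : ℝ) :
    ∫ ω, (numCovered p S T ω : ℝ) ∂P =
      (∑' i, ∫⁻ ω in {ω | i < S.numUsers ω},
        ENNReal.ofReal (coverageProb p S i (S.userPos i ω) P T) ∂P).toReal := by
  have hm : ∀ i, Measurable ({ω | i < S.numUsers ω ∧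
      Covered p S i (S.userPos i ω) T ω}.indicator (1 : Ω → ℝ≥0∞)) := fun i =>
    measurable_one.indicator (hS.measurableSet_user_covered i T)
  rw [integral_natCast_eq_toReal]
  · simp only [numCovered_eq_tsum]
    rw [lintegral_tsum fun i => (hm i).aemeasurable]
    simp only [lintegral_indicator_one (hS.measurableSet_user_covered _ T),
      hS.measure_user_covered]
  · simp only [numCovered_eq_tsum]
    exact (Measurable.tsum hm).aemeasurable

lemma IsModel.integral_sum_coverageProb [IsProbabilityMeasure P] (hS : IsModel p P S) (T : ℝ) :
    ∫ ω, (∑ i ∈ Finset.range (S.numUsers ω), coverageProb p S i (S.userPos i ω) P T) ∂P =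
      (∑' i, ∫⁻ ω in {ω | i < S.numUsers ω},
        ENNReal.ofReal (coverageProb p S i (S.userPos i ω) P T) ∂P).toReal := by
  have hc := fun i => (hS.measurable_coverageProb i T).comp (hS.users.measurable_pos i)
  have hN : ∀ i, MeasurableSet {ω | i < S.numUsers ω} := fun i =>
    measurableSet_lt measurable_const hS.users.measurable_num
  rw [integral_eq_lintegral_of_nonneg_ae
    (Filter.Eventually.of_forall fun ω => Finset.sum_nonneg fun i _ => coverageProb_nonneg p S i _ P T)
    (measurable_sum_range hS.users.measurable_num hc).aestronglyMeasurable]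
  simp_rw [← lintegral_indicator (hN _)]
  rw [← lintegral_tsum fun i =>
    ((show Measurable fun ω => ENNReal.ofReal (coverageProb p S i (S.userPos i ω) P T) from
      (hc i).ennreal_ofReal).indicator (hN i)).aemeasurable]
  congr 1
  refine lintegral_congr fun ω => ?_
  rw [ENNReal.ofReal_sum_of_nonneg fun i _ => coverageProb_nonneg p S i _ P T,
    tsum_eq_sum (s := Finset.range (S.numUsers ω))]
  · exact Finset.sum_congr rfl fun i hi => by
      rw [indicator_of_mem (by simpa using hi)]
  · intro i hi
    exact indicator_of_notMem (by simpa using hi) _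

/-- Campbell's formula needs one function for all users. Almost surely every user is at a place
where `coverageProb` equals `Pcov`, whatever its label, so label `0` can stand for all. -/
lemma IsModel.integral_numCovered_eq [IsProbabilityMeasure P] (hS : IsModel p P S) {T : ℝ}
    (hT : 0 < T) :
    ∫ ω, (numCovered p S T ω : ℝ) ∂P =
      ∫ ξ in (0 : ℝ)..p.R, p.Pcov T ξ * p.lamU ξ * (2 * Real.pi * ξ) := by
  have hc := hS.measurable_coverageProb 0 T
  have hN : ∀ i, MeasurableSet {ω | i < S.numUsers ω} := fun i =>
    measurableSet_lt measurable_const hS.users.measurable_num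
  rw [hS.integral_numCovered, ← integral_userIntensity p (c := fun x => coverageProb p S 0 x P T)
    (fun x hx hxR => hS.coverageProb_eq 0 x hT hx hxR), integral_eq_lintegral_of_nonneg_ae
    (Filter.Eventually.of_forall fun x => coverageProb_nonneg p S 0 x P T) hc.aestronglyMeasurable,
    ← hS.users.lintegral_sum hc.ennreal_ofReal]
  congr 1
  refine tsum_congr fun i => setLIntegral_congr_fun_ae (hN i) ?_
  filter_upwards [hS.ae_userPos] with ω hω hi
  obtain ⟨h0, hR⟩ := hω i hi
  rw [hS.coverageProb_eq i _ hT h0 hR, hS.coverageProb_eq 0 _ hT h0 hR]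

lemma IsModel.meanUsers_eq (hS : IsModel p P S) :
    meanUsers S P = ∫ ξ in (0 : ℝ)..p.R, p.lamU ξ * (2 * Real.pi * ξ) := by
  have h := hS.users.lintegral_sum_range (f := 1) measurable_one
  have hU := integral_userIntensity p (c := fun _ => 1) (g := fun _ => 1) (fun _ _ _ => rfl)
  simp only [one_mul] at hU
  rw [meanUsers, integral_natCast_eq_toReal
    ((measurable_of_countable _).comp hS.users.measurable_num).aemeasurable, ← hU]
  simp only [Pi.one_apply, Finset.sum_const, Finset.card_range, nsmul_eq_mul, mul_one,
    lintegral_const, one_mul] at h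
  rw [h, integral_const, smul_eq_mul, mul_one, measureReal_def]

end Users

end RISCell

theorem theorem1 {Ω : Type*} [MeasurableSpace Ω] (P : MeasureTheory.Measure Ω)
    [MeasureTheory.IsProbabilityMeasure P] (p : RISCell.Params) (S : RISCell.Network Ω)
    (hS : RISCell.IsModel p P S) (T : ℝ) (hT : 0 < T) :
    (∀ (i : ℕ) (x : ℂ), 0 < ‖x‖ → ‖x‖ ≤ p.R →
      RISCell.reflectionProb p S i x P = p.PR ‖x‖ ∧
      (∀ t : ℝ, RISCell.etaCDF p S i x P t = p.Feta ‖x‖ t) ∧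
      RISCell.coverageProb p S i x P T = p.Pcov T ‖x‖) ∧
    RISCell.meanUsers S P = (∫ ξ in (0 : ℝ)..p.R, p.lamU ξ * (2 * Real.pi * ξ)) ∧
    RISCell.ergodicCoverage p S P T =
      (∫ ω, (∑ i ∈ Finset.range (S.numUsers ω),
        RISCell.coverageProb p S i (S.userPos i ω) P T) ∂P) / RISCell.meanUsers S P ∧
    RISCell.ergodicCoverage p S P T =
      (∫ ξ in (0 : ℝ)..p.R, p.Pcov T ξ * p.lamU ξ * (2 * Real.pi * ξ)) /
        ∫ ξ in (0 : ℝ)..p.R, p.lamU ξ * (2 * Real.pi * ξ) := by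
  refine ⟨fun i x hx hxR => ⟨hS.reflectionProb_eq i x hxR, hS.etaCDF_eq i x hxR,
    hS.coverageProb_eq i x hT hx hxR⟩, hS.meanUsers_eq, ?_, ?_⟩
  · rw [RISCell.ergodicCoverage, hS.integral_numCovered, hS.integral_sum_coverageProb]
  · rw [RISCell.ergodicCoverage, hS.integral_numCovered_eq hT, hS.meanUsers_eq]
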